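/- Let $\mathcal K$ be an essentially small tensor-triangulated category: a triangulated category with a symmetric monoidal structure $(\otimes,\mathbb 1)$ such that $\otimes$ is exact in each variable. Assume that $\mathcal K$ is rigid, i.e. every object has a dual. A *triangular prime* of $\mathcal K$ is a proper thick $\otimes$-ideal $\mathcal P\subsetneq\mathcal K$ such that $x\otimes y\in\mathcal P$ implies $x\in\mathcal P$ or $y\in\mathcal P$; the set of these is $\mathrm{Spc}(\mathcal K)$. Let $\mathrm{mod}\text{-}\mathcal K$ be the abelian category of finitely presented additive functors $\mathcal K^{\mathrm{op}}\to\mathrm{Ab}$ (the Freyd envelope of $\mathcal K$), with the tensor product given by Day convolution, and let $\mathrm h:\mathcal K\to\mathrm{mod}\text{-}\mathcal K$, $x\mapsto\mathrm{Hom}_{\mathcal K}(-,x)$, be the Yoneda embedding. A *homological prime* is a maximal element, with respect to inclusion, among the proper Serre subcategories $\mathcal B\subsetneq\mathrm{mod}\text{-}\mathcal K$ that are $\otimes$-ideals; the set of these is $\mathrm{Spc}^{\mathrm h}(\mathcal K)$. Then $\mathcal B\mapsto\mathrm h^{-1}(\mathcal B)=\{x\in\mathcal K\mid \mathrm h(x)\in\mathcal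 B\}$ defines a map $\varphi:\mathrm{Spc}^{\mathrm h}(\mathcal K)\to\mathrm{Spc}(\mathcal K)$, and this map is surjective. That is, every triangular prime $\mathcal P$ of $\mathcal K$ is of the form $\mathcal P=\mathrm h^{-1}(\mathcal B)$ for some maximal proper Serre $\otimes$-ideal $\mathcal B$ of $\mathrm{mod}\text{-}\mathcal K$. -/

import Mathlib

open CategoryTheory CategoryTheory.Limits CategoryTheory.MonoidalCategory Opposite
open scoped ZeroObject

universe v u

noncomputable section

namespace TTGeometry

section ModuleCategory

variable (K : Type u) [Category.{v} K] [Preadditive K]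

/-- The Yoneda embedding `x ↦ x̂ = Hom_K(-, x)` of `K` into functors `Kᵒᵖ ⥤ Ab`.
The abelian groups live in a universe relative to which `K` is small. -/
def yonedaModule : K ⥤ Kᵒᵖ ⥤ AddCommGrpCat.{max u v} :=
  preadditiveYoneda ⋙ (Functor.whiskeringRight _ _ _).obj AddCommGrpCat.uliftFunctor.{u, v}

/-- A functor `M : Kᵒᵖ ⥤ Ab` is finitely presented if there is an exact sequence
`x̂ ⟶ ŷ ⟶ M ⟶ 0` whose first map is induced by a morphism `f : x ⟶ y` of `K`. (In an additive
category `K` a finite sum of representables is representable, and such an `M` is automatically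
an additive functor.) -/
def IsFinitelyPresented : ObjectProperty (Kᵒᵖ ⥤ AddCommGrpCat.{max u v}) := fun M =>
  ∃ (x y : K) (f : x ⟶ y) (p : (yonedaModule K).obj y ⟶ M)
    (w : (yonedaModule K).map f ≫ p = 0),
    (ShortComplex.mk ((yonedaModule K).map f) p w).Exact ∧ Epi p

/-- The Freyd envelope `mod-K` : the category of finitely presented `K`-modules, a full subcategory
of `Kᵒᵖ ⥤ Ab`. When `K` has finite sums and weak kernels (as triangulated categories do) it is
closed under kernels, cokernels and finite products, hence abelian; see the instances below. -/
abbrev FreydEnvelope := (IsFinitelyPresented K).FullSubcategory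

variable {K}

set_option linter.unusedSectionVars false

/-- Exactness in a functor category is tested elementwise. -/
lemma exact_iff_elementwise (S : ShortComplex (Kᵒᵖ ⥤ AddCommGrpCat.{max u v})) :
    S.Exact ↔ ∀ (a : Kᵒᵖ) (m : S.X₂.obj a), S.g.app a m = 0 → ∃ l, S.f.app a l = m := by
  have h : S.Exact ↔ ∀ a, (S.map ((evaluation _ _).obj a)).Exact := by
    refine ⟨fun h a => h.map _, fun h => ?_⟩
    rw [S.exact_iff_isZero_homology, Functor.isZero_iff]
    intro a
    exact ((S.map ((evaluation _ _).obj a)).exact_iff_isZero_homology.1 (h a)).of_iso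
      (S.mapHomologyIso ((evaluation _ _).obj a)).symm
  rw [h]
  exact forall_congr' fun a => ShortComplex.ab_exact_iff _

lemma epi_iff_elementwise {M N : Kᵒᵖ ⥤ AddCommGrpCat.{max u v}} (p : M ⟶ N) :
    Epi p ↔ ∀ (a : Kᵒᵖ) (n : N.obj a), ∃ m, p.app a m = n := by
  rw [NatTrans.epi_iff_epi_app]
  exact forall_congr' fun a => AddCommGrpCat.epi_iff_surjective _

lemma mono_iff_elementwise {M N : Kᵒᵖ ⥤ AddCommGrpCat.{max u v}} (p : M ⟶ N) :
    Mono p ↔ ∀ (a : Kᵒᵖ), Function.Injective (p.app a) := by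
  rw [NatTrans.mono_iff_mono_app]
  exact forall_congr' fun a => AddCommGrpCat.mono_iff_injective _

lemma map_comp_elt (M : Kᵒᵖ ⥤ AddCommGrpCat.{max u v}) {a b c : K} (s : a ⟶ b) (t : b ⟶ c)
    (m : M.obj (op c)) : M.map (s ≫ t).op m = M.map s.op (M.map t.op m) := by
  simp

lemma map_add_elt (M : Kᵒᵖ ⥤ AddCommGrpCat.{max u v}) [M.Additive] {a b : K} (s t : a ⟶ b)
    (m : M.obj (op b)) : M.map (s + t).op m = M.map s.op m + M.map t.op m := by
  rw [op_add, Functor.map_add]; rfl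

lemma map_zero_elt (M : Kᵒᵖ ⥤ AddCommGrpCat.{max u v}) [M.Additive] {a b : K}
    (m : M.obj (op b)) : M.map (0 : a ⟶ b).op m = 0 := by
  rw [op_zero, Functor.map_zero]; rfl

lemma map_sub_elt (M : Kᵒᵖ ⥤ AddCommGrpCat.{max u v}) [M.Additive] {a b : K} (s t : a ⟶ b)
    (m : M.obj (op b)) : M.map (s - t).op m = M.map s.op m - M.map t.op m := by
  rw [op_sub, Functor.map_sub]; rfl

lemma natural_elt {M N : Kᵒᵖ ⥤ AddCommGrpCat.{max u v}} (g : M ⟶ N) {a b : K} (s : a ⟶ b)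
    (m : M.obj (op b)) : g.app (op a) (M.map s.op m) = N.map s.op (g.app (op b) m) :=
  ConcreteCategory.congr_hom (g.naturality s.op) m

/-- The elements of `ŷ` at `a` are the morphisms `a ⟶ y`. -/
def homEquiv (a y : K) : (a ⟶ y) ≃+ ((yonedaModule K).obj y).obj (op a) :=
  AddEquiv.ulift.symm

lemma map_homEquiv {a b y : K} (s : a ⟶ b) (t : b ⟶ y) :
    ((yonedaModule K).obj y).map s.op (homEquiv b y t) = homEquiv a y (s ≫ t) := rfl

lemma yonedaModule_map_homEquiv {a x y : K} (t : a ⟶ x) (f : x ⟶ y) :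
    ((yonedaModule K).map f).app (op a) (homEquiv a x t) = homEquiv a y (t ≫ f) := rfl

/-- The morphism `ŷ ⟶ M` corresponding to an element of `M` at `y`. -/
def yonedaDesc (M : Kᵒᵖ ⥤ AddCommGrpCat.{max u v}) [M.Additive] (y : K) (e : M.obj (op y)) :
    (yonedaModule K).obj y ⟶ M where
  app a := AddCommGrpCat.ofHom ((AddMonoidHom.mk' (fun t : a.unop ⟶ y => M.map t.op e)
    (fun s t => map_add_elt M s t e)).comp (homEquiv a.unop y).symm.toAddMonoidHom)
  naturality a b s := by
    ext t
    exact map_comp_elt M s.unop ((homEquiv a.unop y).symm t) e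

lemma yonedaDesc_app (M : Kᵒᵖ ⥤ AddCommGrpCat.{max u v}) [M.Additive] (y : K)
    (e : M.obj (op y)) {a : K} (t : a ⟶ y) :
    (yonedaDesc M y e).app (op a) (homEquiv a y t) = M.map t.op e := rfl

/-- Elementwise form of finite presentation. -/
lemma isFinitelyPresented_iff (M : Kᵒᵖ ⥤ AddCommGrpCat.{max u v}) :
    IsFinitelyPresented K M ↔ M.Additive ∧ ∃ (x y : K) (f : x ⟶ y) (e : M.obj (op y)),
      (∀ (a : K) (m : M.obj (op a)), ∃ t : a ⟶ y, M.map t.op e = m) ∧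
      (∀ (a : K) (t : a ⟶ y), M.map t.op e = 0 ↔ ∃ s : a ⟶ x, s ≫ f = t) := by
  constructor
  · rintro ⟨x, y, f, p, w, hex, hp⟩
    rw [exact_iff_elementwise] at hex
    rw [epi_iff_elementwise] at hp
    let e : M.obj (op y) := p.app (op y) (homEquiv y y (𝟙 y))
    have key : ∀ (a : K) (t : a ⟶ y), M.map t.op e = p.app (op a) (homEquiv a y t) := by
      intro a t
      rw [← natural_elt, map_homEquiv, Category.comp_id]
    have gen : ∀ (a : K) (m : M.obj (op a)), ∃ t : a ⟶ y, M.map t.op e = m := by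
      intro a m
      obtain ⟨t, rfl⟩ := hp (op a) m
      obtain ⟨t, rfl⟩ := (homEquiv a y).surjective t
      exact ⟨t, key a t⟩
    have kadd : ∀ (a : K) (s t : a ⟶ y), M.map (s + t).op e = M.map s.op e + M.map t.op e := by
      intro a s t
      rw [key, key, key, map_add, map_add]
    refine ⟨⟨?_⟩, x, y, f, e, gen, fun a t => ?_⟩
    · intro b a s t
      ext m
      obtain ⟨r, rfl⟩ := gen b.unop m
      change M.map (s.unop + t.unop).op _ = M.map s.unop.op _ + M.map t.unop.op _
      rw [← map_comp_elt, Preadditive.add_comp, kadd, map_comp_elt, map_comp_elt]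
    · rw [key]
      constructor
      · intro h
        obtain ⟨l, hl⟩ := hex (op a) _ h
        obtain ⟨l, rfl⟩ := (homEquiv a x).surjective l
        exact ⟨l, (homEquiv a y).injective hl⟩
      · rintro ⟨s, rfl⟩
        exact ConcreteCategory.congr_hom (NatTrans.congr_app w (op a)) (homEquiv a x s)
  · rintro ⟨hM, x, y, f, e, gen, rel⟩
    refine ⟨x, y, f, yonedaDesc M y e, ?_, ?_, ?_⟩
    · ext a s
      exact (rel a.unop _).2 ⟨(homEquiv a.unop x).symm s, rfl⟩
    · rw [exact_iff_elementwise]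
      intro a m hm
      obtain ⟨m, rfl⟩ := (homEquiv a.unop y).surjective m
      obtain ⟨s, rfl⟩ := (rel a.unop _).1 hm
      exact ⟨homEquiv a.unop x s, rfl⟩
    · rw [epi_iff_elementwise]
      intro a m
      obtain ⟨t, ht⟩ := gen a.unop m
      exact ⟨homEquiv a.unop y t, ht⟩

lemma IsFinitelyPresented.additive {M : Kᵒᵖ ⥤ AddCommGrpCat.{max u v}}
    (h : IsFinitelyPresented K M) : M.Additive :=
  ((isFinitelyPresented_iff M).1 h).1

/-- Representable modules are finitely presented. -/
lemma isFinitelyPresented_yonedaModule [HasZeroObject K] (y : K) :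
    IsFinitelyPresented K ((yonedaModule K).obj y) := by
  refine (isFinitelyPresented_iff _).2 ⟨⟨?_⟩, 0, y, 0, homEquiv y y (𝟙 y), ?_, ?_⟩
  · intro b a s t
    ext m
    obtain ⟨m, rfl⟩ := (homEquiv b.unop y).surjective m
    change homEquiv a.unop y ((s.unop + t.unop) ≫ m) = homEquiv a.unop y (s.unop ≫ m)
      + homEquiv a.unop y (t.unop ≫ m)
    rw [Preadditive.add_comp, map_add]
  · intro a m
    obtain ⟨m, rfl⟩ := (homEquiv a y).surjective m
    exact ⟨m, by rw [map_homEquiv, Category.comp_id]⟩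
  · intro a t
    rw [map_homEquiv, Category.comp_id, EmbeddingLike.map_eq_zero_iff]
    exact ⟨fun h => ⟨0, by simp [h]⟩, fun ⟨s, hs⟩ => by simp [← hs]⟩

variable (K) in
/-- The Yoneda embedding `h : K ⥤ mod-K`, `x ↦ x̂`. -/
def yonedaFP [HasZeroObject K] : K ⥤ FreydEnvelope K :=
  (IsFinitelyPresented K).lift (yonedaModule K) isFinitelyPresented_yonedaModule

/-- In presence of weak kernels and finite sums, finite presentation means that `M` is finitely
generated and that each morphism `ẑ ⟶ M` has a finitely generated kernel. -/
lemma isFinitelyPresented_iff_coherent [HasBinaryBiproducts K] [HasWeakKernels K]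
    (M : Kᵒᵖ ⥤ AddCommGrpCat.{max u v}) :
    IsFinitelyPresented K M ↔ M.Additive ∧
      (∃ (y : K) (e : M.obj (op y)), ∀ (a : K) (m : M.obj (op a)), ∃ t : a ⟶ y, M.map t.op e = m) ∧
      (∀ (z : K) (e : M.obj (op z)), ∃ (w : K) (k : w ⟶ z), ∀ (a : K) (t : a ⟶ z),
        M.map t.op e = 0 ↔ ∃ s : a ⟶ w, s ≫ k = t) := by
  rw [isFinitelyPresented_iff]
  constructor
  · rintro ⟨hM, x, y, f, e, gen, rel⟩
    refine ⟨hM, ⟨y, e, gen⟩, fun z e' => ?_⟩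
    obtain ⟨g, rfl⟩ := gen z e'
    let d : z ⊞ x ⟶ y := biprod.desc g (-f)
    refine ⟨weakKernel d, weakKernel.ι d ≫ biprod.fst, fun a t => ?_⟩
    rw [← map_comp_elt, rel]
    constructor
    · rintro ⟨s, hs⟩
      refine ⟨weakKernel.lift d (biprod.lift t s) (by simp [d, hs]), ?_⟩
      rw [← Category.assoc, weakKernel.lift_ι, biprod.lift_fst]
    · rintro ⟨s, rfl⟩
      refine ⟨s ≫ weakKernel.ι d ≫ biprod.snd, ?_⟩
      have h : weakKernel.ι d ≫ d = 0 := weakKernel.condition d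
      have h2 : weakKernel.ι d ≫ biprod.fst ≫ g = weakKernel.ι d ≫ biprod.snd ≫ f := by
        rw [← sub_eq_zero, ← Preadditive.comp_sub, ← h]
        congr 1
        ext <;> simp [d]
      simp [h2]
  · rintro ⟨hM, ⟨y, e, gen⟩, rel⟩
    obtain ⟨x, f, h⟩ := rel y e
    exact ⟨hM, x, y, f, e, gen, h⟩

lemma IsFinitelyPresented.of_iso {M N : Kᵒᵖ ⥤ AddCommGrpCat.{max u v}} (i : M ≅ N)
    (h : IsFinitelyPresented K M) : IsFinitelyPresented K N := by
  obtain ⟨x, y, f, p, w, hex, hp⟩ := h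
  have w' : (yonedaModule K).map f ≫ p ≫ i.hom = 0 := by rw [reassoc_of% w, zero_comp]
  refine ⟨x, y, f, p ≫ i.hom, w', ?_, inferInstance⟩
  let e : ShortComplex.mk _ p w ≅ ShortComplex.mk _ _ w' :=
    ShortComplex.isoMk (Iso.refl _) (Iso.refl _) i (by simp) (by simp)
  exact ShortComplex.exact_of_iso e hex

instance : (IsFinitelyPresented K).IsClosedUnderIsomorphisms :=
  ⟨fun i h => IsFinitelyPresented.of_iso i h⟩

section Abelian

variable [HasZeroObject K] [HasBinaryBiproducts K] [HasWeakKernels K]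

lemma IsFinitelyPresented.of_kernel {L M N : Kᵒᵖ ⥤ AddCommGrpCat.{max u v}} (i : L ⟶ M)
    (g : M ⟶ N) (w : i ≫ g = 0) (hex : (ShortComplex.mk i g w).Exact) (hi : Mono i)
    (hM : IsFinitelyPresented K M) (hN : IsFinitelyPresented K N) :
    IsFinitelyPresented K L := by
  rw [mono_iff_elementwise] at hi
  rw [exact_iff_elementwise] at hex
  rw [isFinitelyPresented_iff_coherent] at hM hN ⊢
  obtain ⟨hMa, ⟨y, e, gen⟩, relM⟩ := hM
  obtain ⟨hNa, -, relN⟩ := hN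
  have hw : ∀ (a : Kᵒᵖ) (l : L.obj a), g.app a (i.app a l) = 0 := fun a l =>
    ConcreteCategory.congr_hom (NatTrans.congr_app w a) l
  refine ⟨⟨?_⟩, ?_, ?_⟩
  · intro b a s t
    ext l
    apply hi a
    change i.app (op a.unop) (L.map (s.unop + t.unop).op l) = i.app a (L.map s l + L.map t l)
    rw [natural_elt i (s.unop + t.unop) l, map_add_elt, map_add]
    congr 1
    · exact (natural_elt i s.unop l).symm
    · exact (natural_elt i t.unop l).symm
  · obtain ⟨w, k, hk⟩ := relN y (g.app (op y) e)
    obtain ⟨l, hl⟩ := hex (op w) (M.map k.op e) (by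
      change g.app (op w) (M.map k.op e) = 0
      rw [natural_elt]
      exact (hk w k).2 ⟨𝟙 w, Category.id_comp k⟩)
    change i.app (op w) l = _ at hl
    refine ⟨w, l, fun a m => ?_⟩
    obtain ⟨t, ht⟩ := gen a (i.app (op a) m)
    obtain ⟨s, rfl⟩ := (hk a t).1 (by rw [← natural_elt, ht, hw])
    refine ⟨s, hi _ ?_⟩
    rw [natural_elt, hl, ← map_comp_elt, ht]
  · intro z e'
    obtain ⟨w, k, hk⟩ := relM z (i.app (op z) e')
    refine ⟨w, k, fun a t => ?_⟩
    rw [← hk, ← natural_elt]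
    exact ⟨fun h => by rw [h, map_zero], fun h => hi _ (by rw [h, map_zero])⟩

lemma IsFinitelyPresented.of_cokernel {M N Q : Kᵒᵖ ⥤ AddCommGrpCat.{max u v}} (g : M ⟶ N)
    (q : N ⟶ Q) (w : g ≫ q = 0) (hex : (ShortComplex.mk g q w).Exact) (hq : Epi q)
    (hM : IsFinitelyPresented K M) (hN : IsFinitelyPresented K N) :
    IsFinitelyPresented K Q := by
  rw [epi_iff_elementwise] at hq
  rw [exact_iff_elementwise] at hex
  rw [isFinitelyPresented_iff_coherent] at hM hN ⊢
  obtain ⟨hMa, ⟨y, e, genM⟩, -⟩ := hM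
  obtain ⟨hNa, ⟨y', e', genN⟩, relN⟩ := hN
  have hw : ∀ (a : Kᵒᵖ) (l : M.obj a), q.app a (g.app a l) = 0 := fun a l =>
    ConcreteCategory.congr_hom (NatTrans.congr_app w a) l
  refine ⟨⟨?_⟩, ?_, ?_⟩
  · intro b a s t
    ext m
    obtain ⟨n, rfl⟩ := hq b m
    change Q.map (s.unop + t.unop).op (q.app (op b.unop) n) =
      Q.map s.unop.op (q.app (op b.unop) n) + Q.map t.unop.op (q.app (op b.unop) n)
    rw [← natural_elt, ← natural_elt, ← natural_elt, map_add_elt, map_add]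
  · refine ⟨y', q.app (op y') e', fun a m => ?_⟩
    obtain ⟨n, rfl⟩ := hq (op a) m
    obtain ⟨t, rfl⟩ := genN a n
    exact ⟨t, (natural_elt q t e').symm⟩
  · intro z m
    obtain ⟨n, rfl⟩ := hq (op z) m
    obtain ⟨w, k, hk⟩ := relN (z ⊞ y)
      (N.map (biprod.fst : z ⊞ y ⟶ z).op n - N.map (biprod.snd : z ⊞ y ⟶ y).op (g.app (op y) e))
    refine ⟨w, k ≫ biprod.fst, fun a t => ?_⟩
    rw [← natural_elt]
    constructor
    · intro h
      obtain ⟨l, hl⟩ := hex (op a) _ h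
      change g.app (op a) l = _ at hl
      obtain ⟨s, rfl⟩ := genM a l
      rw [natural_elt] at hl
      obtain ⟨r, hr⟩ := (hk a (biprod.lift t s)).1 (by
        rw [map_sub, ← map_comp_elt, ← map_comp_elt, biprod.lift_fst, biprod.lift_snd, hl, sub_self])
      exact ⟨r, by rw [← Category.assoc, hr, biprod.lift_fst]⟩
    · rintro ⟨s, rfl⟩
      have h := (hk a (s ≫ k)).2 ⟨s, rfl⟩
      rw [map_sub, sub_eq_zero, ← map_comp_elt, ← map_comp_elt, ← natural_elt] at h
      rw [← Category.assoc, h, hw]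

lemma IsFinitelyPresented.biprod {M N : Kᵒᵖ ⥤ AddCommGrpCat.{max u v}}
    (hM : IsFinitelyPresented K M) (hN : IsFinitelyPresented K N) :
    IsFinitelyPresented K (M ⊞ N) := by
  rw [isFinitelyPresented_iff_coherent] at hM hN ⊢
  obtain ⟨hMa, ⟨y, e, genM⟩, relM⟩ := hM
  obtain ⟨hNa, ⟨y', e', genN⟩, relN⟩ := hN
  let i₁ : M ⟶ M ⊞ N := biprod.inl
  let i₂ : N ⟶ M ⊞ N := biprod.inr
  let p₁ : M ⊞ N ⟶ M := biprod.fst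
  let p₂ : M ⊞ N ⟶ N := biprod.snd
  have h11 : ∀ a m, p₁.app a (i₁.app a m) = m := fun a m =>
    ConcreteCategory.congr_hom (NatTrans.congr_app (biprod.inl_fst : i₁ ≫ p₁ = 𝟙 M) a) m
  have h12 : ∀ a m, p₂.app a (i₁.app a m) = 0 := fun a m =>
    ConcreteCategory.congr_hom (NatTrans.congr_app (biprod.inl_snd : i₁ ≫ p₂ = 0) a) m
  have h21 : ∀ a m, p₁.app a (i₂.app a m) = 0 := fun a m =>
    ConcreteCategory.congr_hom (NatTrans.congr_app (biprod.inr_fst : i₂ ≫ p₁ = 0) a) m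
  have h22 : ∀ a m, p₂.app a (i₂.app a m) = m := fun a m =>
    ConcreteCategory.congr_hom (NatTrans.congr_app (biprod.inr_snd : i₂ ≫ p₂ = 𝟙 N) a) m
  have ht : ∀ a m, i₁.app a (p₁.app a m) + i₂.app a (p₂.app a m) = m := fun a m =>
    ConcreteCategory.congr_hom
      (NatTrans.congr_app (biprod.total : p₁ ≫ i₁ + p₂ ≫ i₂ = 𝟙 (M ⊞ N)) a) m
  have hext : ∀ a (m n : (M ⊞ N : Kᵒᵖ ⥤ AddCommGrpCat.{max u v}).obj a),
      p₁.app a m = p₁.app a n → p₂.app a m = p₂.app a n → m = n := by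
    intro a m n h1 h2
    rw [← ht a m, ← ht a n, h1, h2]
  refine ⟨⟨?_⟩, ?_, ?_⟩
  · intro b a s t
    ext m
    change (M ⊞ N : Kᵒᵖ ⥤ AddCommGrpCat.{max u v}).map (s.unop + t.unop).op m =
      (M ⊞ N : Kᵒᵖ ⥤ AddCommGrpCat.{max u v}).map s.unop.op m +
      (M ⊞ N : Kᵒᵖ ⥤ AddCommGrpCat.{max u v}).map t.unop.op m
    apply hext
    · rw [map_add, natural_elt, natural_elt, natural_elt, map_add_elt]
    · rw [map_add, natural_elt, natural_elt, natural_elt, map_add_elt]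
  · refine ⟨y ⊞ y', i₁.app _ (M.map (biprod.fst : y ⊞ y' ⟶ y).op e) +
      i₂.app _ (N.map (biprod.snd : y ⊞ y' ⟶ y').op e'), fun a m => ?_⟩
    obtain ⟨s, hs⟩ := genM a (p₁.app _ m)
    obtain ⟨t, ht⟩ := genN a (p₂.app _ m)
    refine ⟨biprod.lift s t, hext _ _ _ ?_ ?_⟩
    · rw [natural_elt, map_add, h11, h21, add_zero, ← map_comp_elt, biprod.lift_fst, hs]
    · rw [natural_elt, map_add, h12, h22, zero_add, ← map_comp_elt, biprod.lift_snd, ht]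
  · intro z m
    obtain ⟨w, k, hk⟩ := relM z (p₁.app _ m)
    obtain ⟨w', k', hk'⟩ := relN w (N.map k.op (p₂.app _ m))
    refine ⟨w', k' ≫ k, fun a t => ?_⟩
    constructor
    · intro h
      obtain ⟨s, rfl⟩ := (hk a t).1 (by rw [← natural_elt, h, map_zero])
      obtain ⟨r, rfl⟩ := (hk' a s).1 (by rw [← map_comp_elt, ← natural_elt, h, map_zero])
      exact ⟨r, by rw [Category.assoc]⟩
    · rintro ⟨s, rfl⟩
      apply hext
      · rw [natural_elt, map_zero, ← Category.assoc]
        exact (hk a _).2 ⟨_, rfl⟩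
      · rw [natural_elt, map_zero, ← Category.assoc, map_comp_elt]
        exact (hk' a _).2 ⟨_, rfl⟩

instance : (IsFinitelyPresented K).ContainsZero where
  exists_zero := by
    refine ⟨(yonedaModule K).obj 0, ?_, isFinitelyPresented_yonedaModule 0⟩
    rw [Functor.isZero_iff]
    intro a
    have : Subsingleton (((yonedaModule K).obj 0).obj a) :=
      (homEquiv a.unop (0 : K)).symm.injective.subsingleton
    exact AddCommGrpCat.isZero_of_subsingleton _

instance : (IsFinitelyPresented K).IsClosedUnderKernels where
  kernels_le := by
    rintro _ ⟨g, k, hk, hM, hN⟩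
    exact hM.of_kernel k.ι g k.condition
      (ShortComplex.exact_of_f_is_kernel _ (hk.ofIsoLimit (Fork.ext (Iso.refl _) (by simp))))
      (Fork.IsLimit.mono hk) hN

instance : (IsFinitelyPresented K).IsClosedUnderCokernels where
  cokernels_le := by
    rintro _ ⟨g, k, hk, hM, hN⟩
    exact hM.of_cokernel g k.π k.condition
      (ShortComplex.exact_of_g_is_cokernel _ (hk.ofIsoColimit (Cofork.ext (Iso.refl _) (by simp))))
      (Cofork.IsColimit.epi hk) hN

instance : (IsFinitelyPresented K).IsClosedUnderBinaryProducts where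
  limitsOfShape_le := by
    rintro X ⟨p⟩
    have h := (p.prop_diag_obj ⟨.left⟩).biprod (p.prop_diag_obj ⟨.right⟩)
    let e := (diagramIsoPair p.diag)
    refine h.of_iso ?_
    exact (biprod.isoProd _ _) ≪≫ HasLimit.isoOfNatIso e.symm ≪≫
      (limit.isLimit _).conePointUniqueUpToIso p.isLimit

instance : (IsFinitelyPresented K).IsClosedUnderFiniteProducts :=
  ObjectProperty.IsClosedUnderFiniteProducts.mk'

end Abelian

end ModuleCategory

section Tensor

variable {K : Type u} [Category.{v} K] [Preadditive K] [MonoidalCategory K]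

/-- Generators `f ⊗ m ⊗ n` of the Day convolution of `M` and `N` at `z`, where
`f : z ⟶ x ⊗ y`, `m ∈ M x` and `n ∈ N y`. -/
structure DayGenerator (M N : Kᵒᵖ ⥤ AddCommGrpCat.{max u v}) (z : K) : Type (max u v) where
  x : K
  y : K
  f : z ⟶ x ⊗ y
  m : M.obj (op x)
  n : N.obj (op y)

/-- The relators of the Day convolution
`(M ⊗ N)(z) = ∫^{x, y} Hom(z, x ⊗ y) ⊗_ℤ M x ⊗_ℤ N y`: additivity in each of the three factors
and dinaturality in `x` and in `y`. -/
inductive DayRelator (M N : Kᵒᵖ ⥤ AddCommGrpCat.{max u v}) (z : K) :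
    FreeAbelianGroup (DayGenerator M N z) → Prop
  | add_hom {x y : K} (f f' : z ⟶ x ⊗ y) (m : M.obj (op x)) (n : N.obj (op y)) :
      DayRelator M N z (.of ⟨x, y, f + f', m, n⟩ - .of ⟨x, y, f, m, n⟩ - .of ⟨x, y, f', m, n⟩)
  | add_left {x y : K} (f : z ⟶ x ⊗ y) (m m' : M.obj (op x)) (n : N.obj (op y)) :
      DayRelator M N z (.of ⟨x, y, f, m + m', n⟩ - .of ⟨x, y, f, m, n⟩ - .of ⟨x, y, f, m', n⟩)
  | add_right {x y : K} (f : z ⟶ x ⊗ y) (m : M.obj (op x)) (n n' : N.obj (op y)) :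
      DayRelator M N z (.of ⟨x, y, f, m, n + n'⟩ - .of ⟨x, y, f, m, n⟩ - .of ⟨x, y, f, m, n'⟩)
  | dinatural_left {x x' y : K} (f : z ⟶ x ⊗ y) (a : x ⟶ x') (m : M.obj (op x'))
      (n : N.obj (op y)) :
      DayRelator M N z (.of ⟨x', y, f ≫ a ▷ y, m, n⟩ - .of ⟨x, y, f, M.map a.op m, n⟩)
  | dinatural_right {x y y' : K} (f : z ⟶ x ⊗ y) (b : y ⟶ y') (m : M.obj (op x))
      (n : N.obj (op y')) :
      DayRelator M N z (.of ⟨x, y', f ≫ x ◁ b, m, n⟩ - .of ⟨x, y, f, m, N.map b.op n⟩)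

/-- The subgroup generated by the relators. -/
def dayRelations (M N : Kᵒᵖ ⥤ AddCommGrpCat.{max u v}) (z : K) :
    AddSubgroup (FreeAbelianGroup (DayGenerator M N z)) :=
  AddSubgroup.closure {r | DayRelator M N z r}

/-- The group `(M ⊗ N)(z)`. -/
def DayGroup (M N : Kᵒᵖ ⥤ AddCommGrpCat.{max u v}) (z : K) : Type (max u v) :=
  FreeAbelianGroup (DayGenerator M N z) ⧸ dayRelations M N z

instance (M N : Kᵒᵖ ⥤ AddCommGrpCat.{max u v}) (z : K) : AddCommGroup (DayGroup M N z) :=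
  inferInstanceAs (AddCommGroup (FreeAbelianGroup (DayGenerator M N z) ⧸ dayRelations M N z))

section

variable {M N : Kᵒᵖ ⥤ AddCommGrpCat.{max u v}} {z : K}

/-- The projection onto `(M ⊗ N)(z)`. -/
def dayProj : FreeAbelianGroup (DayGenerator M N z) →+ DayGroup M N z :=
  QuotientAddGroup.mk' (dayRelations M N z)

lemma dayProj_surjective : Function.Surjective (dayProj (M := M) (N := N) (z := z)) :=
  QuotientAddGroup.mk'_surjective _

lemma dayProj_relator {r : FreeAbelianGroup (DayGenerator M N z)} (h : DayRelator M N z r) :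
    dayProj r = 0 :=
  (QuotientAddGroup.eq_zero_iff r).2 (AddSubgroup.subset_closure h)

/-- The element `f ⊗ m ⊗ n` of the tensor product. -/
def dayMk {x y : K} (f : z ⟶ x ⊗ y) (m : M.obj (op x)) (n : N.obj (op y)) : DayGroup M N z :=
  dayProj (FreeAbelianGroup.of ⟨x, y, f, m, n⟩)

lemma dayMk_add_hom {x y : K} (f f' : z ⟶ x ⊗ y) (m : M.obj (op x)) (n : N.obj (op y)) :
    dayMk (f + f') m n = dayMk f m n + dayMk f' m n := by
  have h := dayProj_relator (DayRelator.add_hom f f' m n)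
  rwa [map_sub, map_sub, sub_sub, sub_eq_zero] at h

lemma dayMk_add_left {x y : K} (f : z ⟶ x ⊗ y) (m m' : M.obj (op x)) (n : N.obj (op y)) :
    dayMk f (m + m') n = dayMk f m n + dayMk f m' n := by
  have h := dayProj_relator (DayRelator.add_left f m m' n)
  rwa [map_sub, map_sub, sub_sub, sub_eq_zero] at h

lemma dayMk_add_right {x y : K} (f : z ⟶ x ⊗ y) (m : M.obj (op x)) (n n' : N.obj (op y)) :
    dayMk f m (n + n') = dayMk f m n + dayMk f m n' := by
  have h := dayProj_relator (DayRelator.add_right f m n n')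
  rwa [map_sub, map_sub, sub_sub, sub_eq_zero] at h

lemma dayMk_left {x x' y : K} (f : z ⟶ x ⊗ y) (a : x ⟶ x') (m : M.obj (op x'))
    (n : N.obj (op y)) : dayMk (f ≫ a ▷ y) m n = dayMk f (M.map a.op m) n := by
  have h := dayProj_relator (DayRelator.dinatural_left f a m n)
  rwa [map_sub, sub_eq_zero] at h

lemma dayMk_right {x y y' : K} (f : z ⟶ x ⊗ y) (b : y ⟶ y') (m : M.obj (op x))
    (n : N.obj (op y')) : dayMk (f ≫ x ◁ b) m n = dayMk f m (N.map b.op n) := by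
  have h := dayProj_relator (DayRelator.dinatural_right f b m n)
  rwa [map_sub, sub_eq_zero] at h

lemma dayGroup_induction {P : DayGroup M N z → Prop}
    (mk : ∀ (x y : K) (f : z ⟶ x ⊗ y) (m : M.obj (op x)) (n : N.obj (op y)), P (dayMk f m n))
    (add : ∀ s t, P s → P t → P (s + t)) (neg : ∀ s, P s → P (-s)) (zero : P 0)
    (t : DayGroup M N z) : P t := by
  obtain ⟨t, rfl⟩ := dayProj_surjective t
  induction t using FreeAbelianGroup.induction_on with
  | zero => rwa [map_zero]
  | of g => exact mk g.x g.y g.f g.m g.n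
  | neg g h => rw [map_neg]; exact neg _ h
  | add s t hs ht => rw [map_add]; exact add _ _ hs ht

lemma dayGroup_hom_ext {A : Type*} [AddCommGroup A] {φ ψ : DayGroup M N z →+ A}
    (h : ∀ (x y : K) (f : z ⟶ x ⊗ y) (m : M.obj (op x)) (n : N.obj (op y)),
      φ (dayMk f m n) = ψ (dayMk f m n)) : φ = ψ := by
  ext t
  induction t using dayGroup_induction with
  | mk x y f m n => exact h x y f m n
  | add s t hs ht => rw [map_add, map_add, hs, ht]
  | neg s hs => rw [map_neg, map_neg, hs]
  | zero => rw [map_zero, map_zero]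

/-- The universal property of `(M ⊗ N)(z)`. -/
def dayLift {A : Type*} [AddCommGroup A]
    (φ : ∀ (x y : K), (z ⟶ x ⊗ y) → M.obj (op x) → N.obj (op y) → A)
    (add_hom : ∀ x y f f' m n, φ x y (f + f') m n = φ x y f m n + φ x y f' m n)
    (add_left : ∀ x y f m m' n, φ x y f (m + m') n = φ x y f m n + φ x y f m' n)
    (add_right : ∀ x y f m n n', φ x y f m (n + n') = φ x y f m n + φ x y f m n')
    (left : ∀ (x x' y : K) (f : z ⟶ x ⊗ y) (a : x ⟶ x') m n,
      φ x' y (f ≫ a ▷ y) m n = φ x y f (M.map a.op m) n)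
    (right : ∀ (x y y' : K) (f : z ⟶ x ⊗ y) (b : y ⟶ y') m n,
      φ x y' (f ≫ x ◁ b) m n = φ x y f m (N.map b.op n)) :
    DayGroup M N z →+ A :=
  QuotientAddGroup.lift (dayRelations M N z)
    (FreeAbelianGroup.lift fun g : DayGenerator M N z => φ g.x g.y g.f g.m g.n) (by
      refine (AddSubgroup.closure_le _).2 ?_
      intro r hr
      rw [SetLike.mem_coe, AddMonoidHom.mem_ker]
      cases hr with
      | add_hom f f' m n => simp only [map_sub, FreeAbelianGroup.lift_apply_of, add_hom]; abel
      | add_left f m m' n => simp only [map_sub, FreeAbelianGroup.lift_apply_of, add_left]; abel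
      | add_right f m n n' => simp only [map_sub, FreeAbelianGroup.lift_apply_of, add_right]; abel
      | dinatural_left f a m n =>
        simp only [map_sub, FreeAbelianGroup.lift_apply_of, left, sub_self]
      | dinatural_right f b m n =>
        simp only [map_sub, FreeAbelianGroup.lift_apply_of, right, sub_self])

lemma dayLift_dayMk {A : Type*} [AddCommGroup A]
    (φ : ∀ (x y : K), (z ⟶ x ⊗ y) → M.obj (op x) → N.obj (op y) → A) (h₁ h₂ h₃ h₄ h₅)
    {x y : K} (f : z ⟶ x ⊗ y) (m : M.obj (op x)) (n : N.obj (op y)) :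
    dayLift φ h₁ h₂ h₃ h₄ h₅ (dayMk f m n) = φ x y f m n :=
  FreeAbelianGroup.lift_apply_of _ _

variable (M N) in
/-- Restriction along `k : z' ⟶ z`, sending `f ⊗ m ⊗ n` to `(k ≫ f) ⊗ m ⊗ n`. -/
def dayMap {z' : K} (k : z' ⟶ z) : DayGroup M N z →+ DayGroup M N z' :=
  dayLift (fun _ _ f m n => dayMk (k ≫ f) m n)
    (fun _ _ f f' m n => by rw [Preadditive.comp_add, dayMk_add_hom])
    (fun _ _ f m m' n => dayMk_add_left _ m m' n)
    (fun _ _ f m n n' => dayMk_add_right _ m n n')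
    (fun _ _ _ f a m n => by rw [← dayMk_left, Category.assoc])
    (fun _ _ _ f b m n => by rw [← dayMk_right, Category.assoc])

lemma dayMap_dayMk {z' x y : K} (k : z' ⟶ z) (f : z ⟶ x ⊗ y) (m : M.obj (op x))
    (n : N.obj (op y)) : dayMap M N k (dayMk f m n) = dayMk (k ≫ f) m n :=
  dayLift_dayMk _ _ _ _ _ _ _ _ _

end

/-- The tensor product of `K`-modules, that is, their (additive) Day convolution
`(M ⊗ N)(z) = ∫^{x, y} Hom(z, x ⊗ y) ⊗_ℤ M x ⊗_ℤ N y`. -/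
def dayTensor (M N : Kᵒᵖ ⥤ AddCommGrpCat.{max u v}) : Kᵒᵖ ⥤ AddCommGrpCat.{max u v} where
  obj z := AddCommGrpCat.of (DayGroup M N z.unop)
  map k := AddCommGrpCat.ofHom (dayMap M N k.unop)
  map_id z := by
    apply AddCommGrpCat.hom_ext
    refine dayGroup_hom_ext fun x y f m n => ?_
    exact (dayMap_dayMk _ _ _ _).trans (by rw [unop_id, Category.id_comp]; rfl)
  map_comp k l := by
    apply AddCommGrpCat.hom_ext
    refine dayGroup_hom_ext fun x y f m n => ?_
    refine (dayMap_dayMk _ _ _ _).trans ?_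
    change _ = dayMap M N l.unop (dayMap M N k.unop (dayMk f m n))
    rw [dayMap_dayMk, dayMap_dayMk, unop_comp, Category.assoc]

lemma dayTensor_map (M N : Kᵒᵖ ⥤ AddCommGrpCat.{max u v}) {z z' : K} (k : z' ⟶ z)
    (t : DayGroup M N z) : (dayTensor M N).map k.op t = dayMap M N k t := rfl

lemma dayTensor_additive (M N : Kᵒᵖ ⥤ AddCommGrpCat.{max u v}) : (dayTensor M N).Additive where
  map_add {b a s t} := by
    apply AddCommGrpCat.hom_ext
    refine dayGroup_hom_ext fun x y f m n => ?_
    change dayMap M N (s.unop + t.unop) (dayMk f m n) =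
      dayMap M N s.unop (dayMk f m n) + dayMap M N t.unop (dayMk f m n)
    rw [dayMap_dayMk, dayMap_dayMk, dayMap_dayMk, Preadditive.add_comp, dayMk_add_hom]

/-- The tensor product of finitely presented modules is finitely presented: if `M` and `N` are the
cokernels of `f : x ⟶ y` and `g : x' ⟶ y'`, then `M ⊗ N` is the cokernel of
`(f ▷ y', y ◁ g) : (x ⊗ y') ⊞ (y ⊗ x') ⟶ y ⊗ y'`. -/
lemma IsFinitelyPresented.dayTensor [MonoidalPreadditive K] [HasBinaryBiproducts K]
    {M N : Kᵒᵖ ⥤ AddCommGrpCat.{max u v}}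
    (hM : IsFinitelyPresented K M) (hN : IsFinitelyPresented K N) :
    IsFinitelyPresented K (dayTensor M N) := by
  rw [isFinitelyPresented_iff] at hM hN ⊢
  obtain ⟨hMa, x, y, f, e, genM, relM⟩ := hM
  obtain ⟨hNa, x', y', g, e', genN, relN⟩ := hN
  refine ⟨dayTensor_additive M N, (x ⊗ y') ⊞ (y ⊗ x'), y ⊗ y', biprod.desc (f ▷ y') (y ◁ g),
    dayMk (𝟙 _) e e', ?_, ?_⟩
  · intro a m
    have key : ∀ t : a ⟶ y ⊗ y', (TTGeometry.dayTensor M N).map t.op (dayMk (𝟙 _) e e') =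
        dayMk t e e' := fun t => by rw [dayTensor_map, dayMap_dayMk, Category.comp_id]
    simp only [key]
    change DayGroup M N a at m
    change ∃ t, dayMk t e e' = m
    let ψ : (a ⟶ y ⊗ y') →+ DayGroup M N a :=
      AddMonoidHom.mk' (fun t => dayMk t e e') (fun s t => dayMk_add_hom s t e e')
    change m ∈ ψ.range
    induction m using dayGroup_induction with
    | mk u w k m n =>
      obtain ⟨s, rfl⟩ := genM u m
      obtain ⟨t, rfl⟩ := genN w n
      refine ⟨(k ≫ s ▷ w) ≫ y ◁ t, ?_⟩
      change dayMk _ _ _ = _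
      rw [dayMk_right, dayMk_left]
    | add s t hs ht => exact add_mem hs ht
    | neg s hs => exact neg_mem hs
    | zero => exact zero_mem _
  · intro z t
    rw [dayTensor_map, dayMap_dayMk, Category.comp_id]
    change dayMk t e e' = 0 ↔ _
    constructor
    · intro h
      choose σ hσ using genM
      choose τ hτ using genN
      let S : AddSubgroup (z ⟶ y ⊗ y') := AddMonoidHom.range (AddMonoidHom.mk'
        (fun s : z ⟶ (x ⊗ y') ⊞ (y ⊗ x') => s ≫ biprod.desc (f ▷ y') (y ◁ g))
        (fun s t => Preadditive.add_comp _ _ _ s t _))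
      have hSl : ∀ k : z ⟶ x ⊗ y', k ≫ f ▷ y' ∈ S := fun k => ⟨k ≫ biprod.inl, by simp⟩
      have hSr : ∀ k : z ⟶ y ⊗ x', k ≫ y ◁ g ∈ S := fun k => ⟨k ≫ biprod.inr, by simp⟩
      let pr : (z ⟶ y ⊗ y') →+ (z ⟶ y ⊗ y') ⧸ S := QuotientAddGroup.mk' S
      have hpr : ∀ k ∈ S, pr k = 0 := fun k hk => (QuotientAddGroup.eq_zero_iff k).2 hk
      have indep : ∀ (u w : K) (k : z ⟶ u ⊗ w) (s s' : u ⟶ y) (t t' : w ⟶ y'),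
          M.map s.op e = M.map s'.op e → N.map t.op e' = N.map t'.op e' →
          pr (k ≫ (s ⊗ₘ t)) = pr (k ≫ (s' ⊗ₘ t')) := by
        intro u w k s s' t t' hs ht
        obtain ⟨r, hr⟩ := (relM u (s - s')).1 (by rw [map_sub_elt, hs, sub_self])
        obtain ⟨r', hr'⟩ := (relN w (t - t')).1 (by rw [map_sub_elt, ht, sub_self])
        obtain rfl : s = s' + r ≫ f := by rw [hr]; abel
        obtain rfl : t = t' + r' ≫ g := by rw [hr']; abel
        rw [MonoidalPreadditive.add_tensor, MonoidalPreadditive.tensor_add, Preadditive.comp_add,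
          Preadditive.comp_add, map_add, map_add]
        have h1 : k ≫ (s' ⊗ₘ (r' ≫ g)) = (k ≫ (s' ⊗ₘ r')) ≫ y ◁ g := by
          simp [MonoidalCategory.tensorHom_def]
        have h2 : k ≫ ((r ≫ f) ⊗ₘ (t' + r' ≫ g)) =
            (k ≫ (r ⊗ₘ (t' + r' ≫ g))) ≫ f ▷ y' := by
          simp [MonoidalCategory.tensorHom_def']
        rw [h1, h2, hpr _ (hSr _), hpr _ (hSl _), add_zero, add_zero]
      have lift_eq : ∀ (u : K) (m : M.obj (op u)) (s : u ⟶ y), M.map s.op e = m → M.map (σ u m).op e = M.map s.op e :=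
        fun u m s hs => by rw [hσ, hs]
      have lift_eq' : ∀ (u : K) (n : N.obj (op u)) (s : u ⟶ y'), N.map s.op e' = n → N.map (τ u n).op e' = N.map s.op e' :=
        fun u n s hs => by rw [hτ, hs]
      let ψ : DayGroup M N z →+ (z ⟶ y ⊗ y') ⧸ S :=
        dayLift (fun u w k m n => pr (k ≫ (σ u m ⊗ₘ τ w n)))
          (fun u w k k' m n => by rw [Preadditive.add_comp, map_add])
          (fun u w k m m' n => by
            rw [← map_add, ← Preadditive.comp_add, ← MonoidalPreadditive.add_tensor]
            exact indep _ _ _ _ _ _ _ (lift_eq _ _ _ (by rw [map_add_elt, hσ, hσ])) rfl)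
          (fun u w k m n n' => by
            rw [← map_add, ← Preadditive.comp_add, ← MonoidalPreadditive.tensor_add]
            exact indep _ _ _ _ _ _ _ rfl (lift_eq' _ _ _ (by rw [map_add_elt, hτ, hτ])))
          (fun u u' w k a m n => by
            have : (k ≫ a ▷ w) ≫ (σ u' m ⊗ₘ τ w n) = k ≫ ((a ≫ σ u' m) ⊗ₘ τ w n) := by
              simp [MonoidalCategory.tensorHom_def]
            rw [this]
            exact indep _ _ _ _ _ _ _ (by rw [hσ, map_comp_elt, hσ]) rfl)
          (fun u w w' k b m n => by
            have : (k ≫ u ◁ b) ≫ (σ u m ⊗ₘ τ w' n) = k ≫ (σ u m ⊗ₘ (b ≫ τ w' n)) := by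
              simp [MonoidalCategory.tensorHom_def']
            rw [this]
            exact indep _ _ _ _ _ _ _ rfl (by rw [hτ, map_comp_elt, hτ]))
      have hψ : ψ (dayMk t e e') = pr t := by
        refine (dayLift_dayMk _ _ _ _ _ _ _ _ _).trans ?_
        have h1 : pr (t ≫ (𝟙 y ⊗ₘ 𝟙 y')) = pr t := by simp
        rw [← h1]
        exact indep _ _ _ _ _ _ _ (by rw [hσ]; simp) (by rw [hτ]; simp)
      rw [h, map_zero] at hψ
      obtain ⟨s, hs⟩ := (QuotientAddGroup.eq_zero_iff t).1 hψ.symm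
      exact ⟨s, hs⟩
    · rintro ⟨s, rfl⟩
      have h1 : M.map f.op e = 0 := (relM x f).2 ⟨𝟙 x, Category.id_comp f⟩
      have h2 : N.map g.op e' = 0 := (relN x' g).2 ⟨𝟙 x', Category.id_comp g⟩
      have h3 : s ≫ biprod.desc (f ▷ y') (y ◁ g) =
          (s ≫ biprod.fst) ≫ f ▷ y' + (s ≫ biprod.snd) ≫ y ◁ g := by
        rw [biprod.desc_eq]; simp
      rw [h3, dayMk_add_hom, dayMk_left, dayMk_right, h1, h2]
      have z1 : ∀ (k : z ⟶ x ⊗ y'), dayMk k (0 : M.obj (op x)) e' = 0 := fun k => by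
        have := dayMk_add_left k (0 : M.obj (op x)) 0 e'
        rwa [add_zero, left_eq_add] at this
      have z2 : ∀ (k : z ⟶ y ⊗ x'), dayMk k e (0 : N.obj (op x')) = 0 := fun k => by
        have := dayMk_add_right k e (0 : N.obj (op x')) 0
        rwa [add_zero, left_eq_add] at this
      rw [z1, z2, add_zero]

/-- The tensor product on the Freyd envelope `mod-K`. -/
def tensorFP [MonoidalPreadditive K] [HasBinaryBiproducts K] (M N : FreydEnvelope K) :
    FreydEnvelope K :=
  ⟨dayTensor M.obj N.obj, M.property.dayTensor N.property⟩

end Tensor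

section Spectra

variable (K : Type u) [Category.{v} K] [Preadditive K] [HasZeroObject K] [HasShift K ℤ]
  [∀ n : ℤ, (shiftFunctor K n).Additive] [Pretriangulated K] [MonoidalCategory K]

/-- Compatibility of a monoidal structure with a triangulation: the tensor product is exact
(a triangulated functor) in each variable, in particular additive. -/
class IsTensorTriangulated : Prop extends MonoidalPreadditive K where
  exact_tensorLeft (x : K) : ∃ _ : (tensorLeft x).CommShift ℤ, (tensorLeft x).IsTriangulated
  exact_tensorRight (x : K) : ∃ _ : (tensorRight x).CommShift ℤ, (tensorRight x).IsTriangulated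

variable {K}

/-- A thick `⊗`-ideal: a triangulated subcategory, closed under direct summands (in particular
under isomorphisms), and closed under tensoring with arbitrary objects. -/
structure IsThickTensorIdeal (P : ObjectProperty K) : Prop where
  isTriangulated : P.IsTriangulated
  isStableUnderRetracts : P.IsStableUnderRetracts
  tensor_mem (x : K) {y : K} : P y → P (x ⊗ y)
  mem_tensor {x : K} (y : K) : P x → P (x ⊗ y)

/-- A triangular prime: a proper thick `⊗`-ideal `P` such that `x ⊗ y ∈ P` implies
`x ∈ P` or `y ∈ P`. -/
structure IsTriangularPrime (P : ObjectProperty K) : Prop where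
  isThickTensorIdeal : IsThickTensorIdeal P
  ne_top : P ≠ ⊤
  mem_or_mem {x y : K} : P (x ⊗ y) → P x ∨ P y

variable (K) in
/-- The triangular spectrum `Spc K`. -/
abbrev Spc := {P : ObjectProperty K // IsTriangularPrime P}

variable [IsTensorTriangulated K]

/-- A Serre `⊗`-ideal of `mod-K`: a Serre subcategory `B` such that `M ⊗ N ∈ B` and `N ⊗ M ∈ B`
for all `M ∈ B` and `N ∈ mod-K`. -/
structure IsSerreTensorIdeal (B : ObjectProperty (FreydEnvelope K)) : Prop where
  isSerreClass : B.IsSerreClass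
  tensor_mem (N : FreydEnvelope K) {M : FreydEnvelope K} : B M → B (tensorFP N M)
  mem_tensor {M : FreydEnvelope K} (N : FreydEnvelope K) : B M → B (tensorFP M N)

/-- A homological prime: a maximal element among the proper Serre `⊗`-ideals of `mod-K`. -/
def IsHomologicalPrime (B : ObjectProperty (FreydEnvelope K)) : Prop :=
  Maximal (fun C : ObjectProperty (FreydEnvelope K) => IsSerreTensorIdeal C ∧ C ≠ ⊤) B

variable (K) in
/-- The homological spectrum `Spcʰ K`, the set of homological primes. -/
abbrev HomologicalSpc := {B : ObjectProperty (FreydEnvelope K) // IsHomologicalPrime B}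

end Spectra

end TTGeometry

end

/-!
The well-definedness and the surjectivity of `B ↦ h⁻¹(B)` both rest on the exact endofunctors
`homFP x : M ↦ M(x ⊗ -)` of `mod-K`. Since `x` has a dual `w`, the module `M(x ⊗ -)` is the tensor
product `ŵ ⊗ M`, and since every finitely presented module is a quotient of a representable one, a
Serre class is a `⊗`-ideal exactly if it is stable under all `homFP x` (`isSerreTensorIdeal_iff`).
This replaces most uses of the Day convolution by evaluation of functors at tensor products.

*The preimage of a homological prime is prime.* Let `B` be maximal and `x ⊗ y ∈ h⁻¹(B)`. The modules
`M` with `x̂ ⊗ M ∈ B` form a Serre `⊗`-ideal that contains `B` and `ŷ`. By maximality it is `B`, so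
that `y ∈ h⁻¹(B)`, or everything, so that `x ∈ h⁻¹(B)`
(`IsHomologicalPrime.isTriangularPrime`).

*Every triangular prime `P` is such a preimage.* Consider the modules `M` such that `ŝ ⊗ M` vanishes in
the Verdier quotient `K / P` for some `s ∉ P` (`IsTensorTorsion`). They form a Serre `⊗`-ideal because
the complement of `P` is closed under `⊗`, and it is proper because `ŝ` itself does not vanish in
`K / P`. By Zorn's lemma it is contained in a homological prime `B`, and `P ⊆ h⁻¹(B)` is immediate. If
some `s ∉ P` were in `h⁻¹(B)`, then so would be `s^∨ ⊗ s`; but the kernel of the coevaluation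
`𝟙̂ ⟶ (s^∨ ⊗ s)^` is annihilated by `s`, hence is in `B`, so `B` would contain the unit
(`IsTriangularPrime.inverseImage_eq`).
-/

noncomputable section

namespace TTGeometry

/-! ### Exactness in the Freyd envelope, elementwise -/

section Elementwise

variable {K : Type u} [Category.{v} K] [Preadditive K]

lemma comp_app_elt {L M N : FreydEnvelope K} (f : L ⟶ M) (g : M ⟶ N) {a : Kᵒᵖ}
    (l : L.obj.obj a) : (f ≫ g).hom.app a l = g.hom.app a (f.hom.app a l) := rfl

lemma exists_generator (M : FreydEnvelope K) : ∃ (y : K) (e : M.obj.obj (op y)),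
    ∀ (a : K) (m : M.obj.obj (op a)), ∃ t : a ⟶ y, M.obj.map t.op e = m := by
  obtain ⟨-, x, y, f, e, gen, -⟩ := (isFinitelyPresented_iff _).1 M.property
  exact ⟨y, e, gen⟩

lemma isZero_iff_elementwise (M : FreydEnvelope K) :
    IsZero M ↔ ∀ (a : K) (m : M.obj.obj (op a)), m = 0 := by
  rw [IsZero.iff_id_eq_zero]
  constructor
  · intro h a m
    exact ConcreteCategory.congr_hom (NatTrans.congr_app (congrArg (·.hom) h) (op a)) m
  · intro h
    ext a m
    exact h a.unop m

lemma epi_of_surjective {M N : FreydEnvelope K} (g : M ⟶ N)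
    (h : ∀ (a : K) (n : N.obj.obj (op a)), ∃ m, g.hom.app (op a) m = n) : Epi g := by
  have : Epi ((IsFinitelyPresented K).ι.map g) := (epi_iff_elementwise _).2 fun a => h a.unop
  exact (IsFinitelyPresented K).ι.epi_of_epi_map this

variable [HasZeroObject K]

/-- The morphism `ŷ ⟶ M` of `mod-K` corresponding to an element of `M` at `y`. -/
def yonedaDescFP (M : FreydEnvelope K) {y : K} (e : M.obj.obj (op y)) :
    (yonedaFP K).obj y ⟶ M :=
  haveI := M.property.additive
  ⟨yonedaDesc M.obj y e⟩

lemma yonedaDescFP_app (M : FreydEnvelope K) {a y : K} (e : M.obj.obj (op y)) (t : a ⟶ y) :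
    (yonedaDescFP M e).hom.app (op a) (homEquiv a y t) = M.obj.map t.op e := rfl

lemma yonedaDescFP_id (M : FreydEnvelope K) {y : K} (e : M.obj.obj (op y)) :
    (yonedaDescFP M e).hom.app (op y) (homEquiv y y (𝟙 y)) = e := by
  rw [yonedaDescFP_app]; simp

lemma yonedaDescFP_comp {M N : FreydEnvelope K} {y : K} (e : M.obj.obj (op y)) (g : M ⟶ N) :
    yonedaDescFP M e ≫ g = yonedaDescFP N (g.hom.app (op y) e) := by
  ext a t
  obtain ⟨t, rfl⟩ := (homEquiv a.unop y).surjective t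
  exact natural_elt g.hom t e

lemma yonedaDescFP_zero (M : FreydEnvelope K) (y : K) :
    yonedaDescFP M (0 : M.obj.obj (op y)) = 0 := by
  ext a t
  obtain ⟨t, rfl⟩ := (homEquiv a.unop y).surjective t
  exact map_zero (M.obj.map t.op).hom

lemma mono_iff_injective {M N : FreydEnvelope K} (g : M ⟶ N) :
    Mono g ↔ ∀ (a : K) (m : M.obj.obj (op a)), g.hom.app (op a) m = 0 → m = 0 := by
  constructor
  · intro _ a m h
    have : yonedaDescFP M m = 0 := by
      rw [← cancel_mono g, yonedaDescFP_comp, h, yonedaDescFP_zero, zero_comp]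
    rw [← yonedaDescFP_id M m, this]
    rfl
  · intro h
    have : Mono ((IsFinitelyPresented K).ι.map g) :=
      (mono_iff_elementwise _).2 fun a => (injective_iff_map_eq_zero _).2 (h a.unop)
    exact (IsFinitelyPresented K).ι.mono_of_mono_map this

lemma yonedaDescFP_epi {M : FreydEnvelope K} {y : K} {e : M.obj.obj (op y)}
    (gen : ∀ (a : K) (m : M.obj.obj (op a)), ∃ t : a ⟶ y, M.obj.map t.op e = m) :
    Epi (yonedaDescFP M e) :=
  epi_of_surjective _ fun a m => by
    obtain ⟨t, ht⟩ := gen a m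
    exact ⟨homEquiv a y t, ht⟩

variable [HasBinaryBiproducts K] [HasWeakKernels K]

lemma epi_iff_surjective {M N : FreydEnvelope K} (g : M ⟶ N) :
    Epi g ↔ ∀ (a : K) (n : N.obj.obj (op a)), ∃ m, g.hom.app (op a) m = n := by
  refine ⟨fun hg a n => ?_, epi_of_surjective g⟩
  -- The cokernel of `g` in the category of all modules is finitely presented.
  let q : N ⟶ ⟨cokernel g.hom, M.property.of_cokernel g.hom (cokernel.π g.hom)
    (cokernel.condition _) (ShortComplex.exact_of_g_is_cokernel _ (cokernelIsCokernel g.hom))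
    inferInstance N.property⟩ := ⟨cokernel.π g.hom⟩
  have hq : g ≫ q = 0 := by
    ext : 1
    exact cokernel.condition _
  have hq0 : q = 0 := by rw [← cancel_epi g, hq, comp_zero]
  have : Epi g.hom := Abelian.epi_of_cokernel_π_eq_zero _ (congrArg (·.hom) hq0)
  exact (epi_iff_elementwise _).1 this (op a) n

lemma exact_iff_elements (S : ShortComplex (FreydEnvelope K)) :
    S.Exact ↔ ∀ (a : K) (m : S.X₂.obj.obj (op a)), S.g.hom.app (op a) m = 0 →
      ∃ l, S.f.hom.app (op a) l = m := by
  rw [ShortComplex.exact_iff_exact_up_to_refinements]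
  constructor
  · intro h a m hm
    obtain ⟨A, π, _, x, hx⟩ := h (yonedaDescFP S.X₂ m)
      (by rw [yonedaDescFP_comp, hm, yonedaDescFP_zero])
    obtain ⟨t, ht⟩ := (epi_iff_surjective π).1 inferInstance a (homEquiv a a (𝟙 a))
    exact ⟨x.hom.app _ t, by rw [← comp_app_elt, ← hx, comp_app_elt, ht, yonedaDescFP_id]⟩
  · intro h A x hx
    obtain ⟨y, e, gen⟩ := exists_generator A
    obtain ⟨l, hl⟩ := h y (x.hom.app _ e) (by rw [← comp_app_elt, hx]; rfl)
    exact ⟨_, yonedaDescFP A e, yonedaDescFP_epi gen, yonedaDescFP S.X₁ l, by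
      rw [yonedaDescFP_comp, yonedaDescFP_comp, hl]⟩

/-- To be a Serre class can be tested on elementwise injections, surjections and exact sequences. -/
lemma isSerreClass_of_elementwise (B : ObjectProperty (FreydEnvelope K))
    (zero : ∀ M : FreydEnvelope K, (∀ (a : K) (m : M.obj.obj (op a)), m = 0) → B M)
    (sub : ∀ {L M : FreydEnvelope K} (f : L ⟶ M),
      (∀ (a : K) (l : L.obj.obj (op a)), f.hom.app (op a) l = 0 → l = 0) → B M → B L)
    (quot : ∀ {M N : FreydEnvelope K} (g : M ⟶ N),
      (∀ (a : K) (n : N.obj.obj (op a)), ∃ m, g.hom.app (op a) m = n) → B M → B N)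
    (ext : ∀ {L M N : FreydEnvelope K} (f : L ⟶ M) (g : M ⟶ N),
      (∀ (a : K) (m : M.obj.obj (op a)), g.hom.app (op a) m = 0 → ∃ l, f.hom.app (op a) l = m) →
      B L → B N → B M) : B.IsSerreClass where
  exists_zero := ⟨0, isZero_zero _, zero _ ((isZero_iff_elementwise _).1 (isZero_zero _))⟩
  prop_of_mono f _ := sub f ((mono_iff_injective f).1 inferInstance)
  prop_of_epi g _ := quot g ((epi_iff_surjective g).1 inferInstance)
  prop_X₂_of_shortExact {S} hS := ext S.f S.g ((exact_iff_elements S).1 hS.exact)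

lemma isSerreClass_inverseImage (B : ObjectProperty (FreydEnvelope K)) [B.IsSerreClass]
    (F : FreydEnvelope K ⥤ FreydEnvelope K) [F.Additive]
    (hF : ∀ S : ShortComplex (FreydEnvelope K), S.Exact → (S.map F).Exact) :
    (B.inverseImage F).IsSerreClass := by
  obtain ⟨_, _⟩ := (F.exact_tfae.out 1 3).1 hF
  infer_instance

end Elementwise

/-! ### Tensoring with representable modules -/

section Tensor

variable {K : Type u} [Category.{v} K] [MonoidalCategory K]

lemma tensorLeftHomEquiv_naturality_left {w x z z' b : K} [ExactPairing w x] (k : z' ⟶ z)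
    (f : x ⊗ z ⟶ b) :
    tensorLeftHomEquiv z' w x b (x ◁ k ≫ f) = k ≫ tensorLeftHomEquiv z w x b f := by
  rw [← (tensorLeftHomEquiv _ w x b).symm.injective.eq_iff, tensorLeftHomEquiv_symm_naturality,
    Equiv.symm_apply_apply, Equiv.symm_apply_apply]

variable [Preadditive K]

/-- For dual objects `w` and `x`, an element `e ∈ N(w)` induces a morphism
`M(x ⊗ -) ⟶ N ⊗ M`, sending `m ∈ M(x ⊗ z)` to `η ⊗ e ⊗ m`, where `η : z ⟶ w ⊗ (x ⊗ z)` is the unit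
of the adjunction between tensoring with `x` and with `w`. -/
def toDayTensor (M N : Kᵒᵖ ⥤ AddCommGrpCat.{max u v}) (w x : K) [ExactPairing w x]
    (e : N.obj (op w)) : (tensorLeft x).op ⋙ M ⟶ dayTensor N M where
  app z := AddCommGrpCat.ofHom (AddMonoidHom.mk'
    (fun m => dayMk (tensorLeftHomEquiv z.unop w x (x ⊗ z.unop) (𝟙 _)) e m)
    (fun m m' => dayMk_add_right _ e m m'))
  naturality z z' k := by
    ext m
    change dayMk _ e (M.map (x ◁ k.unop).op m) = dayMap N M k.unop (dayMk _ e m)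
    rw [dayMap_dayMk, ← dayMk_right, ← tensorLeftHomEquiv_naturality]
    congr 1
    rw [← tensorLeftHomEquiv_naturality_left, Category.id_comp, Category.comp_id]

/-- The map `toDayTensor` sends `M(k')(m)` to `k ⊗ e ⊗ m`, where `k' : x ⊗ z ⟶ b` is the transpose
of `k : z ⟶ w ⊗ b`. -/
lemma toDayTensor_app (M N : Kᵒᵖ ⥤ AddCommGrpCat.{max u v}) (w x : K) [ExactPairing w x]
    (e : N.obj (op w)) {z b : K} (k : z ⟶ w ⊗ b) (m : M.obj (op b)) :
    (toDayTensor M N w x e).app (op z) (M.map ((tensorLeftHomEquiv z w x b).symm k).op m) =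
      dayMk k e m := by
  change dayMk _ e _ = _
  rw [← dayMk_right, ← tensorLeftHomEquiv_naturality, Category.id_comp, Equiv.apply_symm_apply]

lemma toDayTensor_surjective (M N : Kᵒᵖ ⥤ AddCommGrpCat.{max u v}) (w x : K) [ExactPairing w x]
    {e : N.obj (op w)} (gen : ∀ (a : K) (n : N.obj (op a)), ∃ t : a ⟶ w, N.map t.op e = n)
    (z : K) (t : (dayTensor N M).obj (op z)) : ∃ m, (toDayTensor M N w x e).app (op z) m = t := by
  change t ∈ ((toDayTensor M N w x e).app (op z)).hom.range
  change DayGroup N M z at t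
  induction t using dayGroup_induction with
  | mk a b f n m =>
    obtain ⟨s, rfl⟩ := gen a n
    exact ⟨_, (toDayTensor_app M N w x e (f ≫ s ▷ b) m).trans (dayMk_left _ _ _ _)⟩
  | add s t hs ht => exact add_mem hs ht
  | neg s hs => exact neg_mem hs
  | zero => exact zero_mem _

/-- The analogue of `toDayTensor` for the tensor product `M ⊗ N` on the other side. -/
def toDayTensorRight [BraidedCategory K] (M N : Kᵒᵖ ⥤ AddCommGrpCat.{max u v}) (w x : K)
    [ExactPairing w x] (e : N.obj (op w)) : (tensorLeft x).op ⋙ M ⟶ dayTensor M N where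
  app z := AddCommGrpCat.ofHom (AddMonoidHom.mk'
    (fun m => dayMk (tensorLeftHomEquiv z.unop w x (x ⊗ z.unop) (𝟙 _) ≫ (β_ _ _).hom) m e)
    (fun m m' => dayMk_add_left _ m m' e))
  naturality z z' k := by
    ext m
    change dayMk _ (M.map (x ◁ k.unop).op m) e = dayMap M N k.unop (dayMk _ m e)
    rw [dayMap_dayMk, ← dayMk_left, Category.assoc, ← BraidedCategory.braiding_naturality_right,
      ← Category.assoc, ← Category.assoc, ← tensorLeftHomEquiv_naturality]
    congr 2
    rw [← tensorLeftHomEquiv_naturality_left, Category.id_comp, Category.comp_id]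

lemma toDayTensorRight_surjective [BraidedCategory K] (M N : Kᵒᵖ ⥤ AddCommGrpCat.{max u v})
    (w x : K) [ExactPairing w x] {e : N.obj (op w)}
    (gen : ∀ (a : K) (n : N.obj (op a)), ∃ t : a ⟶ w, N.map t.op e = n)
    (z : K) (t : (dayTensor M N).obj (op z)) :
    ∃ m, (toDayTensorRight M N w x e).app (op z) m = t := by
  change t ∈ ((toDayTensorRight M N w x e).app (op z)).hom.range
  change DayGroup M N z at t
  induction t using dayGroup_induction with
  | mk b a f m n =>
    obtain ⟨s, rfl⟩ := gen a n
    refine ⟨M.map ((tensorLeftHomEquiv z w x b).symm (f ≫ b ◁ s ≫ (β_ w b).inv)).op m, ?_⟩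
    change dayMk _ (M.map _ m) e = _
    rw [← dayMk_left, ← dayMk_right, Category.assoc, ← BraidedCategory.braiding_naturality_right,
      ← Category.assoc, ← tensorLeftHomEquiv_naturality, Category.id_comp, Equiv.apply_symm_apply]
    simp
  | add s t hs ht => exact add_mem hs ht
  | neg s hs => exact neg_mem hs
  | zero => exact zero_mem _

variable [MonoidalPreadditive K]

lemma tensorLeftHomEquiv_symm_add {w x z b : K} [ExactPairing w x] (k k' : z ⟶ w ⊗ b) :
    (tensorLeftHomEquiv z w x b).symm (k + k') =
      (tensorLeftHomEquiv z w x b).symm k + (tensorLeftHomEquiv z w x b).symm k' := by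
  simp [tensorLeftHomEquiv]

/-- A morphism `y ⊗ z ⟶ 𝟙` that is annihilated by the coevaluation `𝟙 ⟶ x ⊗ y` is zero: it becomes
zero after tensoring with `x`, and its transpose `z ⟶ x` factors through that tensor product. -/
lemma eq_zero_of_comp_coevaluation_eq_zero [BraidedCategory K] (x y z : K)
    [ExactPairing x y] (f : y ⊗ z ⟶ 𝟙_ K)
    (h : f ≫ η_ x y = 0) : f = 0 := by
  have h1 : f ▷ x = 0 := by
    have h2 : f ▷ x ≫ (η_ x y ▷ x ≫ (α_ x y x).hom ≫ x ◁ ε_ x y) = 0 := by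
      rw [← comp_whiskerRight_assoc, h, MonoidalPreadditive.zero_whiskerRight, zero_comp]
    rw [ExactPairing.evaluation_coevaluation, ← Category.assoc] at h2
    rw [← cancel_mono (λ_ x).hom, zero_comp]
    exact (cancel_mono (ρ_ x).inv).1 (h2.trans zero_comp.symm)
  have h3 : x ◁ f = 0 := by
    rw [← cancel_mono (β_ x (𝟙_ K)).hom, BraidedCategory.braiding_naturality_right, h1, comp_zero,
      zero_comp]
  apply (tensorLeftHomEquiv z x y (𝟙_ K)).injective
  simp [tensorLeftHomEquiv, h3]

/-- For the generator `1 ∈ ŵ(w)`, the map `toDayTensor` is injective: its inverse sends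
`f ⊗ s ⊗ m` to `M(k)(m)`, where `k` is the transpose of `f ≫ (s ▷ b)`. -/
lemma toDayTensor_yoneda_injective (M : Kᵒᵖ ⥤ AddCommGrpCat.{max u v}) [M.Additive] (w x : K)
    [ExactPairing w x] (z : K) : Function.Injective
      ((toDayTensor M ((yonedaModule K).obj w) w x (homEquiv w w (𝟙 w))).app (op z)) := by
  let ψ : DayGroup ((yonedaModule K).obj w) M z →+ M.obj (op (x ⊗ z)) :=
    dayLift (fun a b f s m =>
        M.map ((tensorLeftHomEquiv z w x b).symm (f ≫ (homEquiv a w).symm s ▷ b)).op m)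
      (fun a b f f' s m => by
        rw [Preadditive.add_comp, tensorLeftHomEquiv_symm_add, map_add_elt])
      (fun a b f s s' m => by
        rw [map_add, MonoidalPreadditive.add_whiskerRight, Preadditive.comp_add,
          tensorLeftHomEquiv_symm_add, map_add_elt])
      (fun a b f s m m' => by rw [map_add])
      (fun a a' b f t s m => by
        obtain ⟨s, rfl⟩ := (homEquiv a' w).surjective s
        rw [map_homEquiv, AddEquiv.symm_apply_apply, AddEquiv.symm_apply_apply,
          comp_whiskerRight, Category.assoc])
      (fun a b b' f t s m => by
        rw [← map_comp_elt]
        congr 4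
        rw [Equiv.symm_apply_eq, tensorLeftHomEquiv_naturality, Equiv.apply_symm_apply,
          Category.assoc, Category.assoc, whisker_exchange])
  refine Function.LeftInverse.injective (g := ψ) fun m => ?_
  refine (dayLift_dayMk _ _ _ _ _ _ _ _ _).trans ?_
  simp

variable [HasZeroObject K] [HasBinaryBiproducts K] [RigidCategory K]

lemma IsFinitelyPresented.tensorLeft_comp {M : Kᵒᵖ ⥤ AddCommGrpCat.{max u v}}
    (hM : IsFinitelyPresented K M) (x : K) :
    IsFinitelyPresented K ((tensorLeft x).op ⋙ M) := by
  have := hM.additive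
  let f := toDayTensor M ((yonedaModule K).obj (ᘁx)) (ᘁx) x (homEquiv _ _ (𝟙 _))
  have : Mono f := (mono_iff_elementwise _).2 fun z => toDayTensor_yoneda_injective M _ x z.unop
  have : Epi f := (epi_iff_elementwise _).2 fun z => toDayTensor_surjective M _ _ x
    (fun a n => ⟨(homEquiv a (ᘁx)).symm n, by
      rw [map_homEquiv, Category.comp_id, AddEquiv.apply_symm_apply]⟩) z.unop
  have : IsIso f := isIso_of_mono_of_epi f
  exact ((isFinitelyPresented_yonedaModule (ᘁx)).dayTensor hM).of_iso (asIso f).symm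

/-- The functor `M ↦ M(x ⊗ -)` on `mod-K`, that is, the internal Hom out of `x̂`. It is isomorphic
to the tensor product with the representable module of the dual of `x`. -/
def homFP (x : K) : FreydEnvelope K ⥤ FreydEnvelope K :=
  (IsFinitelyPresented K).lift
    ((IsFinitelyPresented K).ι ⋙ (Functor.whiskeringLeft _ _ _).obj (tensorLeft x).op)
    (fun M => M.property.tensorLeft_comp x)

instance (x : K) : (homFP x).Additive where

variable [HasWeakKernels K]

lemma homFP_exact (x : K) (S : ShortComplex (FreydEnvelope K)) (hS : S.Exact) :
    (S.map (homFP x)).Exact := by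
  rw [exact_iff_elements] at hS ⊢
  exact fun a => hS (x ⊗ a)

lemma isSerreClass_inverseImage_homFP (B : ObjectProperty (FreydEnvelope K)) [B.IsSerreClass]
    (x : K) : (B.inverseImage (homFP x)).IsSerreClass :=
  isSerreClass_inverseImage B _ (homFP_exact x)

/-- `M((x ⊗ y) ⊗ -)` is `M(x ⊗ (y ⊗ -))`. -/
def homFPTensorIso (x y : K) (M : FreydEnvelope K) :
    (homFP (x ⊗ y)).obj M ≅ (homFP y).obj ((homFP x).obj M) :=
  (IsFinitelyPresented K).isoMk
    (Functor.isoWhiskerRight (NatIso.op (tensorLeftTensor x y).symm) M.obj)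

/-- The functors `homFP x` and `homFP y` commute. -/
def homFPComm [BraidedCategory K] (x y : K) (M : FreydEnvelope K) :
    (homFP x).obj ((homFP y).obj M) ≅ (homFP y).obj ((homFP x).obj M) :=
  (IsFinitelyPresented K).isoMk (Functor.isoWhiskerRight (NatIso.op
    ((tensorLeftTensor x y).symm ≪≫ (curriedTensor K).mapIso (β_ x y) ≪≫ tensorLeftTensor y x))
    M.obj)

/-- For dual objects `w` and `x`, the module `ŷ(x ⊗ -)` is represented by `w ⊗ y`. -/
def homFPYonedaIso (w x y : K) [ExactPairing w x] :
    (homFP x).obj ((yonedaFP K).obj y) ≅ (yonedaFP K).obj (w ⊗ y) :=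
  (IsFinitelyPresented K).isoMk (NatIso.ofComponents (fun z => AddEquiv.toAddCommGrpIso
    ((homEquiv (x ⊗ z.unop) y).symm.trans ((AddEquiv.symm { (tensorLeftHomEquiv z.unop w x y).symm
      with map_add' := tensorLeftHomEquiv_symm_add }).trans (homEquiv z.unop (w ⊗ y)))))
    (fun {z z'} k => by
      ext m
      obtain ⟨m, rfl⟩ := (homEquiv (x ⊗ z.unop) y).surjective m
      change homEquiv z'.unop _ (tensorLeftHomEquiv _ w x y (x ◁ k.unop ≫ m)) =
        homEquiv z'.unop _ (k.unop ≫ tensorLeftHomEquiv _ w x y m)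
      rw [tensorLeftHomEquiv_naturality_left]))

end Tensor

/-! ### Serre tensor ideals and their preimages in `K` -/

section Ideals

variable {K : Type u} [Category.{v} K] [Preadditive K] [HasZeroObject K] [HasShift K ℤ]
  [∀ n : ℤ, (shiftFunctor K n).Additive] [Pretriangulated K]

/-- The Yoneda embedding is a homological functor. -/
lemma yonedaFP_exact (T : Pretriangulated.Triangle K)
    (hT : T ∈ Pretriangulated.distinguishedTriangles) :
    (ShortComplex.mk ((yonedaFP K).map T.mor₁) ((yonedaFP K).map T.mor₂) (by
      rw [← Functor.map_comp, Pretriangulated.comp_distTriang_mor_zero₁₂ T hT]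
      ext a t
      obtain ⟨t, rfl⟩ := (homEquiv a.unop _).surjective t
      exact congrArg (homEquiv _ _) comp_zero)).Exact := by
  rw [exact_iff_elements]
  intro a m hm
  obtain ⟨m, rfl⟩ := (homEquiv a _).surjective m
  obtain ⟨l, rfl⟩ := Pretriangulated.Triangle.coyoneda_exact₂ T hT m
    ((homEquiv a _).injective (hm.trans (map_zero _).symm))
  exact ⟨homEquiv a _ l, rfl⟩

variable [MonoidalCategory K] [IsTensorTriangulated K]

/-- Shifting is tensoring with a shift of the unit. -/
lemma nonempty_shift_unit_tensor_iso (x : K) (n : ℤ) :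
    Nonempty ((𝟙_ K)⟦n⟧ ⊗ x ≅ x⟦n⟧) := by
  obtain ⟨_, _⟩ := IsTensorTriangulated.exact_tensorRight x
  exact ⟨((tensorRight x).commShiftIso n).app (𝟙_ K) ≪≫ (shiftFunctor K n).mapIso (λ_ x)⟩

variable [SymmetricCategory K] [RigidCategory K]

/-- Every finitely presented module is a quotient of a representable one, so that a Serre class is
a `⊗`-ideal as soon as it is closed under tensoring with representable modules. -/
lemma isSerreTensorIdeal_iff (B : ObjectProperty (FreydEnvelope K)) :
    IsSerreTensorIdeal B ↔ B.IsSerreClass ∧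
      ∀ (x : K) (M : FreydEnvelope K), B M → B ((homFP x).obj M) := by
  constructor
  · intro hB
    have := hB.isSerreClass
    refine ⟨this, fun x M hM => ?_⟩
    have := M.property.additive
    let f : (homFP x).obj M ⟶ tensorFP ((yonedaFP K).obj (ᘁx)) M :=
      ⟨toDayTensor M.obj _ (ᘁx) x (homEquiv _ _ (𝟙 _))⟩
    have : Mono f := (mono_iff_injective f).2 fun z =>
      (injective_iff_map_eq_zero _).1 (toDayTensor_yoneda_injective M.obj (ᘁx) x z)
    exact B.prop_of_mono f (hB.tensor_mem _ hM)
  · rintro ⟨_, hB⟩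
    refine ⟨inferInstance, fun N M hM => ?_, fun {M} N hM => ?_⟩
    · obtain ⟨w, e, gen⟩ := exists_generator N
      let f : (homFP (wᘁ)).obj M ⟶ tensorFP N M := ⟨toDayTensor M.obj N.obj w (wᘁ) e⟩
      have : Epi f := epi_of_surjective f (toDayTensor_surjective M.obj N.obj w (wᘁ) gen)
      exact B.prop_of_epi f (hB _ _ hM)
    · obtain ⟨w, e, gen⟩ := exists_generator N
      let f : (homFP (wᘁ)).obj M ⟶ tensorFP M N := ⟨toDayTensorRight M.obj N.obj w (wᘁ) e⟩
      have : Epi f := epi_of_surjective f (toDayTensorRight_surjective M.obj N.obj w (wᘁ) gen)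
      exact B.prop_of_epi f (hB _ _ hM)

lemma IsSerreTensorIdeal.homFP_mem {B : ObjectProperty (FreydEnvelope K)}
    (hB : IsSerreTensorIdeal B) (x : K) {M : FreydEnvelope K} (hM : B M) :
    B ((homFP x).obj M) :=
  ((isSerreTensorIdeal_iff B).1 hB).2 x M hM

lemma IsSerreTensorIdeal.yonedaFP_tensor_mem {B : ObjectProperty (FreydEnvelope K)}
    (hB : IsSerreTensorIdeal B) (x : K) {y : K} (hy : B ((yonedaFP K).obj y)) :
    B ((yonedaFP K).obj (x ⊗ y)) :=
  have := hB.isSerreClass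
  B.prop_of_iso (homFPYonedaIso x (xᘁ) y) (hB.homFP_mem (xᘁ) hy)

lemma IsSerreTensorIdeal.eq_top {B : ObjectProperty (FreydEnvelope K)}
    (hB : IsSerreTensorIdeal B) (h : B ((yonedaFP K).obj (𝟙_ K))) : B = ⊤ := by
  have := hB.isSerreClass
  rw [eq_top_iff]
  intro M _
  obtain ⟨y, e, gen⟩ := exists_generator M
  have := yonedaDescFP_epi gen
  exact B.prop_of_epi (yonedaDescFP M e)
    (B.prop_of_iso ((yonedaFP K).mapIso (ρ_ y)) (hB.yonedaFP_tensor_mem y h))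

/-- For a fixed `w`, the modules `M` with `M(w ⊗ -) ∈ B` form a Serre `⊗`-ideal. -/
lemma IsSerreTensorIdeal.inverseImage_homFP {B : ObjectProperty (FreydEnvelope K)}
    (hB : IsSerreTensorIdeal B) (w : K) : IsSerreTensorIdeal (B.inverseImage (homFP w)) := by
  have := hB.isSerreClass
  exact (isSerreTensorIdeal_iff _).2 ⟨isSerreClass_inverseImage_homFP B w, fun x M hM =>
    B.prop_of_iso (homFPComm x w M) (hB.homFP_mem x hM)⟩

lemma IsSerreTensorIdeal.isThickTensorIdeal {B : ObjectProperty (FreydEnvelope K)}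
    (hB : IsSerreTensorIdeal B) : IsThickTensorIdeal (B.inverseImage (yonedaFP K)) := by
  have := hB.isSerreClass
  refine ⟨?_, ⟨fun r h => B.prop_of_mono ((yonedaFP K).map r.i) h⟩,
    fun x y hy => hB.yonedaFP_tensor_mem x hy, fun {x} y hx => ?_⟩
  · have h2 : (B.inverseImage (yonedaFP K)).IsTriangulatedClosed₂ := .mk' fun T hT h₁ h₃ =>
      B.prop_X₂_of_exact (yonedaFP_exact T hT) h₁ h₃
    refine { exists_zero := ⟨0, isZero_zero K, B.prop_of_isZero ?_⟩, isStableUnderShiftBy n := ⟨?_⟩ }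
    · refine (isZero_iff_elementwise _).2 fun a m => ?_
      obtain ⟨m, rfl⟩ := (homEquiv a _).surjective m
      rw [(isZero_zero K).eq_zero_of_tgt m]
      exact map_zero _
    · intro x hx
      obtain ⟨i⟩ := nonempty_shift_unit_tensor_iso x n
      exact B.prop_of_iso ((yonedaFP K).mapIso i) (hB.yonedaFP_tensor_mem _ hx)
  · exact B.prop_of_iso ((yonedaFP K).mapIso (β_ y x)) (hB.yonedaFP_tensor_mem y hx)

/-- The preimage of a maximal Serre `⊗`-ideal `B` is prime: if `x ⊗ y` belongs to it, then `B` and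
`ŷ` lie in the Serre `⊗`-ideal of all `M` with `x̂ ⊗ M ∈ B`, which is proper unless `x̂ ∈ B`. -/
lemma IsHomologicalPrime.isTriangularPrime {B : ObjectProperty (FreydEnvelope K)}
    (hB : IsHomologicalPrime B) : IsTriangularPrime (B.inverseImage (yonedaFP K)) := by
  have hI := hB.prop.1
  have := hI.isSerreClass
  refine ⟨hI.isThickTensorIdeal, fun h => hB.prop.2 (hI.eq_top (h.ge (𝟙_ K) trivial)),
    fun {x y} h => ?_⟩
  · let B' := B.inverseImage (homFP (xᘁ))
    have hI' : IsSerreTensorIdeal B' := hI.inverseImage_homFP _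
    have hy : B' ((yonedaFP K).obj y) := B.prop_of_iso (homFPYonedaIso x (xᘁ) y).symm h
    by_cases htop : B' = ⊤
    · have h1 : B' ((yonedaFP K).obj (𝟙_ K)) := htop.ge _ trivial
      exact Or.inl (B.prop_of_iso (homFPYonedaIso x (xᘁ) (𝟙_ K) ≪≫ (yonedaFP K).mapIso (ρ_ x)) h1)
    · exact Or.inr (hB.le_of_ge ⟨hI', htop⟩ (fun M hM => hI.homFP_mem _ hM) _ hy)

/-- Properness of a Serre `⊗`-ideal means that it does not contain the unit, so Zorn's lemma applies
to proper Serre `⊗`-ideals. -/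
lemma IsSerreTensorIdeal.exists_le_isHomologicalPrime {C : ObjectProperty (FreydEnvelope K)}
    (hC : IsSerreTensorIdeal C) (hC' : C ≠ ⊤) : ∃ B, IsHomologicalPrime B ∧ C ≤ B := by
  suffices H : _ from
    have ⟨B, hCB, hB⟩ := zorn_le_nonempty₀
      {C : ObjectProperty (FreydEnvelope K) | IsSerreTensorIdeal C ∧ C ≠ ⊤} H C ⟨hC, hC'⟩
    ⟨B, hB, hCB⟩
  intro c hc hchain A hA
  let U : ObjectProperty (FreydEnvelope K) := fun M => ∃ D ∈ c, D M
  have hU : IsSerreTensorIdeal U := by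
    refine (isSerreTensorIdeal_iff U).2 ⟨?_, fun x M ⟨D, hD, hM⟩ =>
      ⟨D, hD, (hc hD).1.homFP_mem x hM⟩⟩
    refine { exists_zero := ?_, prop_of_mono := ?_, prop_of_epi := ?_, prop_X₂_of_shortExact := ?_ }
    · have := (hc hA).1.isSerreClass
      exact ⟨0, isZero_zero _, A, hA, A.prop_zero⟩
    · rintro M N f _ ⟨D, hD, hN⟩
      have := (hc hD).1.isSerreClass
      exact ⟨D, hD, D.prop_of_mono f hN⟩
    · rintro M N f _ ⟨D, hD, hM⟩
      have := (hc hD).1.isSerreClass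
      exact ⟨D, hD, D.prop_of_epi f hM⟩
    · rintro S hS ⟨D, hD, h₁⟩ ⟨E, hE, h₃⟩
      have := (hc hD).1.isSerreClass
      have := (hc hE).1.isSerreClass
      rcases hchain.total hD hE with h | h
      · exact ⟨E, hE, E.prop_X₂_of_shortExact hS (h _ h₁) h₃⟩
      · exact ⟨D, hD, D.prop_X₂_of_shortExact hS h₁ (h _ h₃)⟩
  refine ⟨U, ⟨hU, fun h => ?_⟩, fun D hD M hM => ⟨D, hD, hM⟩⟩
  obtain ⟨D, hD, h1⟩ := h.ge ((yonedaFP K).obj (𝟙_ K)) trivial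
  exact (hc hD).2 ((hc hD).1.eq_top h1)

end Ideals

/-! ### Modules that vanish locally at a prime -/

section LocallyNull

variable {K : Type u} [Category.{v} K] [Preadditive K] [HasZeroObject K] [HasShift K ℤ]
  [∀ n : ℤ, (shiftFunctor K n).Additive] [Pretriangulated K]

/-- The modules that vanish in the Verdier quotient `K / P`, formulated in `K`: every element is
killed by a morphism whose cone belongs to `P`. -/
def IsLocallyNull (P : ObjectProperty K) : ObjectProperty (FreydEnvelope K) := fun M =>
  ∀ (z : K) (m : M.obj.obj (op z)), ∃ (z' : K) (t : z' ⟶ z), P.trW t ∧ M.obj.map t.op m = 0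

lemma isSerreClass_isLocallyNull [IsTriangulated K] (P : ObjectProperty K) [P.IsTriangulated] :
    (IsLocallyNull P).IsSerreClass := by
  refine isSerreClass_of_elementwise _ (fun M hM z m => ?_) (fun f hf hM z l => ?_)
    (fun g hg hM z n => ?_) (fun {L M N} f g hfg hL hN z m => ?_)
  · exact ⟨z, 𝟙 z, P.trW.id_mem z, hM _ _⟩
  · obtain ⟨z', t, ht, h⟩ := hM z (f.hom.app _ l)
    exact ⟨z', t, ht, hf _ _ (by rw [natural_elt, h])⟩
  · obtain ⟨m, rfl⟩ := hg z n
    obtain ⟨z', t, ht, h⟩ := hM z m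
    exact ⟨z', t, ht, by rw [← natural_elt, h, map_zero]⟩
  · obtain ⟨z', t, ht, h⟩ := hN z (g.hom.app _ m)
    obtain ⟨l, hl⟩ := hfg z' (M.obj.map t.op m) (by rw [natural_elt, h])
    obtain ⟨z'', t', ht', h'⟩ := hL z' l
    exact ⟨z'', t' ≫ t, P.trW.comp_mem _ _ ht' ht, by
      rw [map_comp_elt, ← hl, ← natural_elt, h', map_zero]⟩

/-- A representable module vanishes locally at a thick subcategory `P` exactly if it is represented
by an object of `P`. -/
lemma isLocallyNull_yonedaFP_iff (P : ObjectProperty K) [P.IsStableUnderRetracts] (y : K) :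
    IsLocallyNull P ((yonedaFP K).obj y) ↔ P y := by
  constructor
  · intro h
    obtain ⟨z', t, ⟨c, g, k, hT, hc⟩, ht⟩ := h y (homEquiv y y (𝟙 y))
    obtain ⟨r, hr⟩ := Pretriangulated.Triangle.yoneda_exact₂ _ hT (𝟙 y)
      ((homEquiv z' y).injective (ht.trans (map_zero _).symm))
    exact P.prop_of_retract ⟨g, r, hr.symm⟩ hc
  · intro hy z m
    obtain ⟨m, rfl⟩ := (homEquiv z y).surjective m
    obtain ⟨w, t, k, hT⟩ := Pretriangulated.distinguished_cocone_triangle₁ m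
    refine ⟨w, t, ⟨y, m, k, hT, hy⟩, (congrArg (homEquiv w y) ?_).trans (map_zero _)⟩
    exact Pretriangulated.comp_distTriang_mor_zero₁₂ _ hT

variable [MonoidalCategory K] {P : ObjectProperty K}

lemma IsTriangularPrime.not_unit (hP : IsTriangularPrime P) : ¬ P (𝟙_ K) := by
  intro h
  have := hP.isThickTensorIdeal.isStableUnderRetracts
  refine hP.ne_top (eq_top_iff.2 fun x _ => ?_)
  exact P.prop_of_iso (ρ_ x) (hP.isThickTensorIdeal.tensor_mem x h)

/-- An object is a retract of its tensor product with its dual. -/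
lemma IsThickTensorIdeal.mem_of_exactPairing (hP : IsThickTensorIdeal P) (x y : K)
    [ExactPairing x y] (hx : P x) : P y := by
  have := hP.isStableUnderRetracts
  refine P.prop_of_retract ⟨(ρ_ y).inv ≫ y ◁ η_ x y,
    (α_ y x y).inv ≫ ε_ x y ▷ y ≫ (λ_ y).hom, ?_⟩ (hP.tensor_mem y (hP.mem_tensor y hx))
  have := ExactPairing.coevaluation_evaluation x y
  simp [reassoc_of% this]

variable [IsTensorTriangulated K] [RigidCategory K]

lemma IsThickTensorIdeal.isLocallyNull_homFP (hP : IsThickTensorIdeal P)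
    (x : K) {M : FreydEnvelope K} (hM : IsLocallyNull P M) :
    IsLocallyNull P ((homFP x).obj M) := by
  intro z m
  change M.obj.obj (op (x ⊗ z)) at m
  obtain ⟨w, u, ⟨c, g, k, hT, hc⟩, hu⟩ := hM (x ⊗ z) m
  -- The fibre `t` of the transpose of `g` has cone `(ᘁx) ⊗ c`, and `x ◁ t` factors through `u`.
  obtain ⟨z', t, l, hT'⟩ := Pretriangulated.distinguished_cocone_triangle₁
    (tensorLeftHomEquiv z (ᘁx) x c g)
  have h0 : x ◁ t ≫ g = 0 := by
    apply (tensorLeftHomEquiv _ (ᘁx) x _).injective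
    rw [tensorLeftHomEquiv_naturality_left]
    have hz : tensorLeftHomEquiv z' (ᘁx) x c 0 = 0 := by simp [tensorLeftHomEquiv]
    exact (Pretriangulated.comp_distTriang_mor_zero₁₂ _ hT').trans hz.symm
  obtain ⟨s, hs⟩ := Pretriangulated.Triangle.coyoneda_exact₂ _ hT (x ◁ t) h0
  refine ⟨z', t, ⟨_, _, l, hT', hP.tensor_mem _ hc⟩, ?_⟩
  change M.obj.map (x ◁ t).op m = 0
  rw [hs]
  exact (map_comp_elt M.obj s u m).trans
    ((congrArg (M.obj.map s.op).hom hu).trans (map_zero (M.obj.map s.op).hom))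

/-- The modules `M` such that `M(s ⊗ -)` vanishes in `K / P` for some `s ∉ P`. For a prime `P`, which
is closed under duals, this is the same as the vanishing of `ŝ ⊗ M` for some `s ∉ P`, and these
modules form a proper Serre `⊗`-ideal, which contains the kernels of `𝟙̂ ⟶ (s^∨ ⊗ s)^` for all
`s ∉ P`. -/
def IsTensorTorsion (P : ObjectProperty K) : ObjectProperty (FreydEnvelope K) := fun M =>
  ∃ s : K, ¬ P s ∧ IsLocallyNull P ((homFP s).obj M)

lemma isTensorTorsion_of_isLocallyNull (hP : IsTriangularPrime P) {M : FreydEnvelope K}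
    (hM : IsLocallyNull P M) : IsTensorTorsion P M :=
  ⟨𝟙_ K, hP.not_unit, hP.isThickTensorIdeal.isLocallyNull_homFP _ hM⟩

variable [IsTriangulated K]

lemma IsTriangularPrime.isTensorTorsion_ne_top (hP : IsTriangularPrime P) :
    IsTensorTorsion P ≠ ⊤ := by
  intro h
  obtain ⟨s, hs, h1⟩ := h.ge ((yonedaFP K).obj (𝟙_ K)) trivial
  have := hP.isThickTensorIdeal.isStableUnderRetracts
  have := hP.isThickTensorIdeal.isTriangulated
  have := isSerreClass_isLocallyNull P
  have h2 := (IsLocallyNull P).prop_of_iso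
    (homFPYonedaIso (ᘁs) s (𝟙_ K) ≪≫ (yonedaFP K).mapIso (ρ_ _)) h1
  rw [isLocallyNull_yonedaFP_iff] at h2
  exact hs (hP.isThickTensorIdeal.mem_of_exactPairing (ᘁs) s h2)

variable [SymmetricCategory K]

lemma IsTriangularPrime.isSerreTensorIdeal_isTensorTorsion (hP : IsTriangularPrime P) :
    IsSerreTensorIdeal (IsTensorTorsion P) := by
  have hI := hP.isThickTensorIdeal
  have := hI.isTriangulated
  have := isSerreClass_isLocallyNull P
  have hser := fun s => isSerreClass_inverseImage_homFP (IsLocallyNull P) s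
  refine (isSerreTensorIdeal_iff _).2 ⟨{
    exists_zero := ⟨0, isZero_zero _, 𝟙_ K, hP.not_unit,
      ((IsLocallyNull P).inverseImage (homFP (𝟙_ K))).prop_zero⟩
    prop_of_mono := fun f _ ⟨s, hs, h⟩ =>
      ⟨s, hs, ((IsLocallyNull P).inverseImage (homFP s)).prop_of_mono f h⟩
    prop_of_epi := fun f _ ⟨s, hs, h⟩ =>
      ⟨s, hs, ((IsLocallyNull P).inverseImage (homFP s)).prop_of_epi f h⟩
    prop_X₂_of_shortExact := fun {S} hS ⟨s, hs, h₁⟩ ⟨t, ht, h₃⟩ => ?_ }, ?_⟩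
  · refine ⟨s ⊗ t, fun h => (hP.mem_or_mem h).elim hs ht,
      ((IsLocallyNull P).inverseImage (homFP (s ⊗ t))).prop_X₂_of_shortExact hS ?_ ?_⟩
    · exact (IsLocallyNull P).prop_of_iso (homFPTensorIso s t S.X₁).symm
        (hI.isLocallyNull_homFP t h₁)
    · exact (IsLocallyNull P).prop_of_iso (homFPComm s t S.X₃ ≪≫ (homFPTensorIso s t S.X₃).symm)
        (hI.isLocallyNull_homFP s h₃)
  · rintro x M ⟨s, hs, h⟩
    exact ⟨s, hs, (IsLocallyNull P).prop_of_iso (homFPComm x s M) (hI.isLocallyNull_homFP x h)⟩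

/-- Let `B` be a proper Serre `⊗`-ideal containing all torsion modules. For `s ∉ P`, the kernel of
the coevaluation `𝟙̂ ⟶ (s^∨ ⊗ s)^` is annihilated by `s`, hence is in `B`. If `ŝ` were in `B`, then
so would be `(s^∨ ⊗ s)^`, and therefore the unit, an extension of the image by the kernel. -/
lemma IsTriangularPrime.inverseImage_eq (hP : IsTriangularPrime P)
    {B : ObjectProperty (FreydEnvelope K)} (hB : IsSerreTensorIdeal B) (hB' : B ≠ ⊤)
    (hPB : IsTensorTorsion P ≤ B) : B.inverseImage (yonedaFP K) = P := by
  have := hB.isSerreClass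
  have := hP.isThickTensorIdeal.isTriangulated
  have := hP.isThickTensorIdeal.isStableUnderRetracts
  have := isSerreClass_isLocallyNull P
  apply le_antisymm
  · intro s hs
    by_contra hsP
    let g := (yonedaFP K).map (η_ (ᘁs) s)
    have hker : IsTensorTorsion P (kernel g) := by
      refine ⟨s, hsP, (IsLocallyNull P).prop_of_isZero ?_⟩
      refine (isZero_iff_elementwise _).2 fun z m => ?_
      change (kernel g).obj.obj (op (s ⊗ z)) at m
      refine (mono_iff_injective (kernel.ι g)).1 inferInstance (s ⊗ z) m ?_
      obtain ⟨f, hf⟩ := (homEquiv (s ⊗ z) (𝟙_ K)).surjective ((kernel.ι g).hom.app _ m)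
      have hgf : g.hom.app _ ((kernel.ι g).hom.app _ m) = 0 := by
        rw [← comp_app_elt, kernel.condition]
        rfl
      rw [← hf] at hgf ⊢
      rw [eq_zero_of_comp_coevaluation_eq_zero (ᘁs) s z f
        ((homEquiv (s ⊗ z) _).injective (hgf.trans (map_zero _).symm))]
      exact map_zero _
    refine hB' (hB.eq_top (B.prop_X₂_of_exact (ShortComplex.exact_of_f_is_kernel
      (ShortComplex.mk (kernel.ι g) g (kernel.condition g)) (kernelIsKernel g))
      (hPB _ hker) (hB.yonedaFP_tensor_mem (ᘁs) hs)))
  · exact fun x hx => hPB _ (isTensorTorsion_of_isLocallyNull hP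
      ((isLocallyNull_yonedaFP_iff P x).2 hx))

end LocallyNull

end TTGeometry

end

/-- For a rigid tensor-triangulated category `K`, the comparison map `φ : Spcʰ K → Spc K`,
`B ↦ h⁻¹(B)`, is well defined and surjective. -/
theorem corollary3p9 {K : Type u} [Category.{v} K] [Preadditive K] [HasZeroObject K]
    [HasShift K ℤ] [∀ n : ℤ, (shiftFunctor K n).Additive] [Pretriangulated K] [IsTriangulated K]
    [MonoidalCategory K] [SymmetricCategory K] [TTGeometry.IsTensorTriangulated K]
    [RigidCategory K] :
    ∃ φ : TTGeometry.HomologicalSpc K → TTGeometry.Spc K,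
      (∀ B : TTGeometry.HomologicalSpc K,
        (φ B).1 = B.1.inverseImage (TTGeometry.yonedaFP K)) ∧
      Function.Surjective φ := by
  refine ⟨fun B => ⟨B.1.inverseImage (TTGeometry.yonedaFP K), B.2.isTriangularPrime⟩,
    fun B => rfl, fun P => ?_⟩
  obtain ⟨B, hB, hPB⟩ := P.2.isSerreTensorIdeal_isTensorTorsion.exists_le_isHomologicalPrime
    P.2.isTensorTorsion_ne_top
  exact ⟨⟨B, hB⟩, Subtype.ext (P.2.inverseImage_eq hB.prop.1 hB.prop.2 hPB)⟩
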